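/- Let $n\ge 2$ be an integer and $1<p<n$, and let $H:\mathbb R^n\to\mathbb R$ be continuous on $\mathbb R^n$, of class $C^2$ on $\mathbb R^n\setminus\{0\}$, positively homogeneous of degree one ($H(t\xi)=tH(\xi)$ for $t>0$), positive on the unit sphere, and such that its unit ball $B=\{\xi: H(\xi)<1\}$ is uniformly convex (for every $\varepsilon>0$ there is $\delta>0$ such that, for all $x,y\in B$ with $|x-y|\ge\varepsilon$, the Euclidean ball of radius $\delta$ about $\frac{x+y}2$ is contained in $B$). Put $a(\xi)=\frac1p\nabla_\xi\big(H^p\big)(\xi)$, $\Delta_p^Hu=\operatorname{div}(a(\nabla u))$ and $p_*=\frac{(n-1)p}{n-p}$. For continuous $f:(0,\infty)\to\mathbb R$, a positive supersolution of $-\Delta_p^Hu=f(u)$ on $\mathbb R^n$ is a function $u\in W^{1,p}_{\mathrm{loc}}(\mathbb R^n)\cap C(\mathbb R^n)$ with $u>0$ everywhere and $$\int_{\mathbb R^n}a(\nabla u)\cdot\nabla\varphi\,dx\ \ge\ \int_{\mathbb R^n}f(u)\varphi\,dx\qquad\text{for all }\varphi\in C_c^\infty(\mathbb R^n),\ \varphi\ge0,$$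 where $\nabla u$ is the weak gradient. (i) If $f:(0,\infty)\to(0,\infty)$ is continuous and $\int_0^1 f(v)^{-\frac1{p_*-1}}\,dv<\infty$, then $-\Delta_p^Hu=f(u)$ has no positive supersolution on $\mathbb R^n$. (ii) In particular, if $f:(0,\infty)\to(0,\infty)$ is continuous and $\liminf_{t\to0^+}f(t)>0$ (the value $+\infty$ being allowed), then $-\Delta_p^Hu=f(u)$ has no positive supersolution on $\mathbb R^n$. (iii) In particular, if $\alpha\in\mathbb R$ and $\alpha<p_*-1$, then $-\Delta_p^Hu=u^\alpha$ has no positive supersolution on $\mathbb R^n$. -/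

import Mathlib

open MeasureTheory Set Filter Topology
open scoped ContDiff

/-- A set `K` is uniformly convex: midpoints of points of `K` at distance at least `ε` lie at
depth at least `δ(ε) > 0` inside `K`. -/
def IsUniformlyConvexSet {E : Type*} [NormedAddCommGroup E] [NormedSpace ℝ E] (K : Set E) : Prop :=
  ∀ ε : ℝ, 0 < ε → ∃ δ : ℝ, 0 < δ ∧ ∀ x ∈ K, ∀ y ∈ K, ε ≤ dist x y →
    Metric.ball (midpoint ℝ x y) δ ⊆ K

/-- The standing assumptions on the function `H` that defines the anisotropy. -/
structure IsAnisotropy {n : ℕ} (H : EuclideanSpace ℝ (Fin n) → ℝ) : Prop where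
  continuous : Continuous H
  contDiffOn : ContDiffOn ℝ 2 H {0}ᶜ
  homogeneous : ∀ (t : ℝ) (ξ : EuclideanSpace ℝ (Fin n)), 0 < t → H (t • ξ) = t * H ξ
  pos : ∀ ξ : EuclideanSpace ℝ (Fin n), ‖ξ‖ = 1 → 0 < H ξ
  uniformlyConvex : IsUniformlyConvexSet {ξ : EuclideanSpace ℝ (Fin n) | H ξ < 1}

/-- The vector field `a(ξ) = (1/p) ∇(H^p)(ξ)`, so that the anisotropic `p`-Laplacian
is `u ↦ div (a (∇ u))`. -/
noncomputable def anisotropicField {n : ℕ} (p : ℝ) (H : EuclideanSpace ℝ (Fin n) → ℝ)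
    (ξ : EuclideanSpace ℝ (Fin n)) : EuclideanSpace ℝ (Fin n) :=
  (1 / p) • gradient (fun ζ => H ζ ^ p) ξ

/-- The exponent `p_* = (n - 1) p / (n - p)`. -/
noncomputable def pLowerStar (n : ℕ) (p : ℝ) : ℝ := ((n : ℝ) - 1) * p / ((n : ℝ) - p)

/-- Test functions: elements of `C_c^∞(ℝⁿ)`. -/
def IsTestFunction {n : ℕ} (φ : EuclideanSpace ℝ (Fin n) → ℝ) : Prop :=
  ContDiff ℝ ∞ φ ∧ HasCompactSupport φ

/-- `G` is the weak (distributional) gradient of `u` on `ℝⁿ`. -/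
def IsWeakGradient {n : ℕ} (u : EuclideanSpace ℝ (Fin n) → ℝ)
    (G : EuclideanSpace ℝ (Fin n) → EuclideanSpace ℝ (Fin n)) : Prop :=
  LocallyIntegrable u ∧ LocallyIntegrable G ∧
    ∀ φ : EuclideanSpace ℝ (Fin n) → ℝ, IsTestFunction φ →
      ∫ x, u x • gradient φ x = - ∫ x, φ x • G x

/-- The function `g` belongs to `L^p_loc(ℝⁿ)`. -/
def MemLpLoc {n : ℕ} {F : Type*} [NormedAddCommGroup F] (p : ℝ)
    (g : EuclideanSpace ℝ (Fin n) → F) : Prop :=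
  ∀ K : Set (EuclideanSpace ℝ (Fin n)), IsCompact K →
    MemLp g (ENNReal.ofReal p) (volume.restrict K)

/-- `u ∈ W^{1,p}_loc(ℝⁿ)` with weak gradient `G` (which is unique up to null sets). -/
def HasSobolevGradient {n : ℕ} (p : ℝ) (u : EuclideanSpace ℝ (Fin n) → ℝ)
    (G : EuclideanSpace ℝ (Fin n) → EuclideanSpace ℝ (Fin n)) : Prop :=
  IsWeakGradient u G ∧ MemLpLoc p u ∧ MemLpLoc p G

/-- `u ∈ W^{1,p}_loc(ℝⁿ) ∩ C(ℝⁿ)` is a positive weak supersolution of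
`-div (a (∇ u)) = f(u)` on `ℝⁿ`. Only the values of `f` on `(0, ∞)` matter. -/
def IsPositiveSupersolution {n : ℕ} (p : ℝ) (H : EuclideanSpace ℝ (Fin n) → ℝ) (f : ℝ → ℝ)
    (u : EuclideanSpace ℝ (Fin n) → ℝ) : Prop :=
  Continuous u ∧ (∀ x, 0 < u x) ∧
    ∃ G : EuclideanSpace ℝ (Fin n) → EuclideanSpace ℝ (Fin n), HasSobolevGradient p u G ∧
      ∀ φ : EuclideanSpace ℝ (Fin n) → ℝ, IsTestFunction φ → (∀ x, 0 ≤ φ x) →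
        ∫ x, f (u x) * φ x ≤ ∫ x, inner ℝ (anisotropicField p H (G x)) (gradient φ x)

/-! Assume a positive supersolution $u$ exists; it is compared with radial functions, and the
contradiction is one-dimensional. Let $N(x)=\max_{H(\eta)\le1}-\langle x,\eta\rangle$ (`dualGauge`),
attained at $e(x)$. Uniform convexity makes $e$ continuous off the origin, hence $\nabla N=-e$
there, and a Lagrange multiplier argument gives $a(e(x))=-x/N(x)$. So a decreasing profile of $N$
has a radial flux, and for any continuous $g\ge0$ the equation $-\operatorname{div}a(\nabla v)=g(N)$
has an explicit solution $v=V\circ N$ (`barrier`) with $-V'=k=(Q/r^{n-1})^{1/(p-1)}$ for $r>0$,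
where $Q(r)=\int_0^r\rho^{n-1}g$.

Let $m(r)=\min_{N\le r}u$ and $g=f(m)/2$. If $V-m$ had a larger value on $[0,R]$ than at $R$, then
near contact between $u$ and a translate of $V\circ N$ one would have $f(u)>g(N)$, against
`weak_comparison`. Hence $V(r)-V(R)\le m(r)-m(R)$ for $0\le r\le R$
(`barrier_sub_le_radialMinimum`).

Put $q=1/(p_*-1)$, $s=1/(p-1)$ and $\Phi(t)=\int_0^tf^{-q}$, finite by hypothesis. Then
$\Phi(m(R))-\Phi(m(2R))\ge\int_R^{2R}f(m)^{-q}k\,dr$. Monotonicity of $Q$ and Jensen's inequality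
bound this below by $C\,Q(R)^sQ(2R)^{-q}$: the powers of $R$ cancel precisely because of the value
of $p_*$. Boundedness of $m$ limits $Q$ to polynomial growth, so $Q(2R)\le C'Q(R)$ for infinitely
many dyadic $R$. Since $s\ge q$, those increments stay above a positive constant, whereas
$\Phi(m(2^j))$ is decreasing and nonnegative (`false_of_barrier_sub_le`). -/

open scoped Convolution

/-! ### Convexity of the gauge $H$, and structure of the field $a$. -/

namespace IsAnisotropy

variable {n : ℕ} {H : EuclideanSpace ℝ (Fin n) → ℝ}

lemma map_zero (hH : IsAnisotropy H) : H 0 = 0 := by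
  have h := hH.homogeneous 2 0 (by norm_num)
  rw [smul_zero] at h
  linarith

lemma map_smul (hH : IsAnisotropy H) {t : ℝ} (ht : 0 ≤ t) (ξ : EuclideanSpace ℝ (Fin n)) :
    H (t • ξ) = t * H ξ := by
  rcases ht.eq_or_lt with rfl | ht
  · simp [hH.map_zero]
  · exact hH.homogeneous t ξ ht

lemma pos_of_ne_zero (hH : IsAnisotropy H) {ξ : EuclideanSpace ℝ (Fin n)} (hξ : ξ ≠ 0) :
    0 < H ξ := by
  have h0 : 0 < ‖ξ‖ := norm_pos_iff.2 hξ
  have h1 : ‖(‖ξ‖⁻¹ • ξ)‖ = 1 := norm_smul_inv_norm hξ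
  have h2 := hH.pos _ h1
  rw [hH.homogeneous _ _ (inv_pos.2 h0)] at h2
  exact pos_of_mul_pos_right h2 (inv_nonneg.2 h0.le)

lemma nonneg (hH : IsAnisotropy H) (ξ : EuclideanSpace ℝ (Fin n)) : 0 ≤ H ξ := by
  rcases eq_or_ne ξ 0 with rfl | h
  · exact hH.map_zero.ge
  · exact (hH.pos_of_ne_zero h).le

lemma exists_bounds (hH : IsAnisotropy H) :
    ∃ c C : ℝ, 0 < c ∧ 0 < C ∧ ∀ ξ, c * ‖ξ‖ ≤ H ξ ∧ H ξ ≤ C * ‖ξ‖ := by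
  have hS : IsCompact (Metric.sphere (0 : EuclideanSpace ℝ (Fin n)) 1) := isCompact_sphere _ _
  rcases (Metric.sphere (0 : EuclideanSpace ℝ (Fin n)) 1).eq_empty_or_nonempty with hemp | hne
  · have h0 : ∀ ξ : EuclideanSpace ℝ (Fin n), ξ = 0 := by
      intro ξ
      by_contra hξ
      have : (‖ξ‖⁻¹ • ξ) ∈ Metric.sphere (0 : EuclideanSpace ℝ (Fin n)) 1 := by
        simpa using norm_smul_inv_norm (𝕜 := ℝ) hξ
      rw [hemp] at this
      exact this
    refine ⟨1, 1, one_pos, one_pos, fun ξ => ?_⟩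
    rw [h0 ξ]
    simp [hH.map_zero]
  · obtain ⟨x, hx, hmin⟩ := hS.exists_isMinOn hne hH.continuous.continuousOn
    obtain ⟨y, hy, hmax⟩ := hS.exists_isMaxOn hne hH.continuous.continuousOn
    refine ⟨H x, H y, hH.pos x (by simpa using hx), hH.pos y (by simpa using hy), fun ξ => ?_⟩
    rcases eq_or_ne ξ 0 with rfl | hξ
    · simp [hH.map_zero]
    · have h0 : 0 < ‖ξ‖ := norm_pos_iff.2 hξ
      have hm : (‖ξ‖⁻¹ • ξ) ∈ Metric.sphere (0 : EuclideanSpace ℝ (Fin n)) 1 := by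
        simpa using norm_smul_inv_norm (𝕜 := ℝ) hξ
      have h1 : H x ≤ H (‖ξ‖⁻¹ • ξ) := hmin hm
      have h2 : H (‖ξ‖⁻¹ • ξ) ≤ H y := hmax hm
      rw [hH.homogeneous _ _ (inv_pos.2 h0)] at h1 h2
      rw [inv_mul_eq_div] at h1 h2
      exact ⟨(le_div_iff₀ h0).1 h1, (div_le_iff₀ h0).1 h2⟩

/-- Uniform convexity passes to the closed unit ball. -/
lemma uniformlyConvex_closedBall (hH : IsAnisotropy H) {ε : ℝ} (hε : 0 < ε) :
    ∃ δ : ℝ, 0 < δ ∧ ∀ x y, H x ≤ 1 → H y ≤ 1 → ε ≤ dist x y →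
      ∀ z, dist z (midpoint ℝ x y) ≤ δ → H z ≤ 1 := by
  obtain ⟨δ, hδ, h⟩ := hH.uniformlyConvex (ε / 2) (by positivity)
  refine ⟨δ / 2, by positivity, fun x y hx hy hxy z hz => ?_⟩
  -- Shrink $x,y$ to $tx,ty$ in the open ball with $t\uparrow1$; taking $t>1/2$ keeps them at
  -- distance at least $\varepsilon/2$.
  have hlim : Tendsto (fun t : ℝ => dist z (midpoint ℝ (t • x) (t • y))) (𝓝[<] 1)
      (𝓝 (dist z (midpoint ℝ x y))) := by
    have : Continuous (fun t : ℝ => dist z (midpoint ℝ (t • x) (t • y))) := by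
      simp only [midpoint_eq_smul_add]
      fun_prop
    have h1 := (this.tendsto 1).mono_left (nhdsWithin_le_nhds (s := Iio 1))
    simpa using h1
  have hev : ∀ᶠ t : ℝ in 𝓝[<] 1, dist z (midpoint ℝ (t • x) (t • y)) < δ :=
    hlim.eventually (gt_mem_nhds (by linarith))
  have hev2 : ∀ᶠ t : ℝ in 𝓝[<] (1 : ℝ), t ∈ Ioo (1 / 2 : ℝ) 1 :=
    Ioo_mem_nhdsLT (by norm_num)
  obtain ⟨t, ht, ht1, ht2⟩ := (hev.and hev2).exists
  have hb : ∀ w, H w ≤ 1 → H (t • w) < 1 := by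
    intro w hw
    rw [hH.map_smul (by linarith)]
    nlinarith [hH.nonneg w]
  refine le_of_lt (h (t • x) (hb x hx) (t • y) (hb y hy) ?_ ?_)
  · rw [dist_smul₀, Real.norm_of_nonneg (by linarith)]
    nlinarith
  · exact ht

/-- If the midpoint had $H\ge1$, moving it outward along its own ray by the depth $\delta$ would
give $H>1$ at a point that uniform convexity keeps in the closed ball. -/
lemma midpoint_lt_one (hH : IsAnisotropy H) {x y : EuclideanSpace ℝ (Fin n)}
    (hx : H x ≤ 1) (hy : H y ≤ 1) (hne : x ≠ y) : H (midpoint ℝ x y) < 1 := by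
  obtain ⟨δ, hδ, h⟩ := hH.uniformlyConvex_closedBall (dist_pos.2 hne)
  set m := midpoint ℝ x y
  by_contra! hm
  have hm0 : 0 < ‖m‖ := by
    rw [norm_pos_iff]
    intro h0
    rw [h0, hH.map_zero] at hm
    linarith
  have h1 := h x y hx hy le_rfl ((1 + δ / ‖m‖) • m) (by
    rw [dist_eq_norm, add_smul, one_smul, add_sub_cancel_left, norm_smul, Real.norm_of_nonneg
      (by positivity)]
    field_simp
    rfl)
  rw [hH.map_smul (by positivity)] at h1
  have : 0 < δ / ‖m‖ := by positivity
  nlinarith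

lemma midpoint_lt (hH : IsAnisotropy H) {x y : EuclideanSpace ℝ (Fin n)} {M : ℝ} (hM : 0 < M)
    (hx : H x ≤ M) (hy : H y ≤ M) (hne : x ≠ y) : H (midpoint ℝ x y) < M := by
  have hs : ∀ w, H w ≤ M → H (M⁻¹ • w) ≤ 1 := by
    intro w hw
    rw [hH.map_smul (inv_nonneg.2 hM.le), inv_mul_le_iff₀ hM]
    linarith
  have h := hH.midpoint_lt_one (hs x hx) (hs y hy) (by
    intro h
    exact hne (smul_right_injective _ (inv_ne_zero hM.ne') h))
  have h2 : midpoint ℝ (M⁻¹ • x) (M⁻¹ • y) = M⁻¹ • midpoint ℝ x y := by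
    simp only [midpoint_eq_smul_add, smul_add, smul_comm M⁻¹]
  rw [h2, hH.map_smul (inv_nonneg.2 hM.le), inv_mul_lt_iff₀ hM] at h
  linarith

/-- A maximum of $H$ on the segment exceeding 1 would be interior, hence the midpoint of two nearby
points of the segment where $H$ is no larger, contradicting `midpoint_lt`. -/
lemma lineMap_le_one (hH : IsAnisotropy H) {x y : EuclideanSpace ℝ (Fin n)}
    (hx : H x ≤ 1) (hy : H y ≤ 1) {t : ℝ} (ht : t ∈ Icc (0 : ℝ) 1) :
    H (AffineMap.lineMap x y t) ≤ 1 := by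
  have hγc : Continuous fun s : ℝ => H (AffineMap.lineMap x y s) :=
    hH.continuous.comp AffineMap.lineMap_continuous
  rcases eq_or_ne x y with rfl | hne
  · simpa using hx
  by_contra! hlt
  obtain ⟨s, hs, hmax⟩ := isCompact_Icc.exists_isMaxOn (nonempty_Icc.2 zero_le_one)
    hγc.continuousOn (s := Icc (0 : ℝ) 1)
  set M := H (AffineMap.lineMap x y s) with hMdef
  have hM1 : 1 < M := hlt.trans_le (hmax ht)
  have hs0 : 0 < s := by
    rcases hs.1.eq_or_lt with h | h
    · rw [hMdef, ← h, AffineMap.lineMap_apply_zero] at hM1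
      linarith
    · exact h
  have hs1 : s < 1 := by
    rcases hs.2.eq_or_lt with h | h
    · rw [hMdef, h, AffineMap.lineMap_apply_one] at hM1
      linarith
    · exact h
  set h := min s (1 - s)
  have hh : 0 < h := lt_min hs0 (by linarith)
  have e1 : s - h ∈ Icc (0 : ℝ) 1 := ⟨by linarith [min_le_left s (1 - s)], by linarith⟩
  have e2 : s + h ∈ Icc (0 : ℝ) 1 := ⟨by linarith, by linarith [min_le_right s (1 - s)]⟩
  have hmid : midpoint ℝ (AffineMap.lineMap x y (s - h)) (AffineMap.lineMap x y (s + h))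
      = AffineMap.lineMap x y s := by
    rw [← AffineMap.map_midpoint]
    congr 1
    rw [midpoint_eq_smul_add]
    simp
    ring
  have := hH.midpoint_lt (by linarith) (hmax e1) (hmax e2) (by
    intro h'
    have := AffineMap.lineMap_injective ℝ hne h'
    linarith)
  rw [hmid] at this
  exact lt_irrefl _ this

lemma add_le (hH : IsAnisotropy H) (x y : EuclideanSpace ℝ (Fin n)) : H (x + y) ≤ H x + H y := by
  rcases eq_or_ne x 0 with rfl | hx
  · simp [hH.map_zero]
  rcases eq_or_ne y 0 with rfl | hy
  · simp [hH.map_zero]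
  have hx0 := hH.pos_of_ne_zero hx
  have hy0 := hH.pos_of_ne_zero hy
  have hs : ∀ w, 0 < H w → H ((H w)⁻¹ • w) ≤ 1 := by
    intro w hw
    rw [hH.map_smul (inv_nonneg.2 hw.le), inv_mul_cancel₀ hw.ne']
  -- With this weight the convex combination of $x/H(x)$ and $y/H(y)$ is $(x+y)/(H(x)+H(y))$.
  have h := hH.lineMap_le_one (hs x hx0) (hs y hy0) (t := H y / (H x + H y))
    ⟨by positivity, by rw [div_le_one (by positivity)]; linarith⟩
  have h2 : AffineMap.lineMap ((H x)⁻¹ • x) ((H y)⁻¹ • y) (H y / (H x + H y))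
      = (H x + H y)⁻¹ • (x + y) := by
    rw [AffineMap.lineMap_apply_module, smul_smul, smul_smul, smul_add]
    congr 2 <;> field_simp
    ring
  rw [h2, hH.map_smul (by positivity), inv_mul_le_iff₀ (by positivity)] at h
  linarith

lemma contDiffAt (hH : IsAnisotropy H) {ξ : EuclideanSpace ℝ (Fin n)} (hξ : ξ ≠ 0) :
    ContDiffAt ℝ 2 H ξ :=
  hH.contDiffOn.contDiffAt (isOpen_compl_singleton.mem_nhds hξ)

lemma hasGradientAt (hH : IsAnisotropy H) {ξ : EuclideanSpace ℝ (Fin n)} (hξ : ξ ≠ 0) :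
    HasGradientAt H (gradient H ξ) ξ :=
  ((hH.contDiffAt hξ).differentiableAt (by norm_num)).hasGradientAt

lemma hasDerivAt_line (hH : IsAnisotropy H) {ξ : EuclideanSpace ℝ (Fin n)} (hξ : ξ ≠ 0)
    (η : EuclideanSpace ℝ (Fin n)) :
    HasDerivAt (fun t : ℝ => H (ξ + t • η)) (inner ℝ (gradient H ξ) η) 0 := by
  have h1 : HasDerivAt (fun t : ℝ => ξ + t • η) η 0 := by
    simpa using ((hasDerivAt_id (0 : ℝ)).smul_const η).const_add ξ
  have h2 : HasFDerivAt H (InnerProductSpace.toDual ℝ _ (gradient H ξ)) (ξ + (0 : ℝ) • η) := by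
    simpa using (hH.hasGradientAt hξ).hasFDerivAt
  have h3 := h2.comp_hasDerivAt 0 h1
  rw [InnerProductSpace.toDual_apply_apply] at h3
  exact h3

lemma inner_gradient_self (hH : IsAnisotropy H) {ξ : EuclideanSpace ℝ (Fin n)} (hξ : ξ ≠ 0) :
    inner ℝ (gradient H ξ) ξ = H ξ := by
  have h1 := hH.hasDerivAt_line hξ ξ
  have h2 : HasDerivAt (fun t : ℝ => (1 + t) * H ξ) (H ξ) 0 := by
    simpa using ((hasDerivAt_id (0 : ℝ)).const_add 1).mul_const (H ξ)
  refine h1.unique (h2.congr_of_eventuallyEq ?_)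
  filter_upwards [lt_mem_nhds (show (-1 : ℝ) < 0 by norm_num)] with t ht
  rw [← hH.map_smul (by linarith), add_smul, one_smul]

/-- By subadditivity every difference quotient of $t\mapsto H(\xi+t\eta)$ with $t>0$ is at most
$H(\eta)$. -/
lemma inner_gradient_le (hH : IsAnisotropy H) {ξ : EuclideanSpace ℝ (Fin n)} (hξ : ξ ≠ 0)
    (η : EuclideanSpace ℝ (Fin n)) : inner ℝ (gradient H ξ) η ≤ H η := by
  have h1 := (hH.hasDerivAt_line hξ η).hasDerivWithinAt (s := Ioi 0)
  rw [hasDerivWithinAt_iff_tendsto_slope' (by simp)] at h1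
  refine le_of_tendsto h1 ?_
  filter_upwards [self_mem_nhdsWithin] with t ht
  have ht : 0 < t := ht
  rw [slope_def_field, sub_zero, div_le_iff₀ ht]
  have := hH.add_le ξ (t • η)
  rw [hH.map_smul ht.le] at this
  simp only [zero_smul, add_zero]
  linarith

lemma anisotropicField_of_ne_zero (hH : IsAnisotropy H) {p : ℝ} (hp : 1 < p)
    {ξ : EuclideanSpace ℝ (Fin n)} (hξ : ξ ≠ 0) :
    anisotropicField p H ξ = H ξ ^ (p - 1) • gradient H ξ := by
  have h1 : HasFDerivAt (fun ζ => H ζ ^ p)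
      ((p * H ξ ^ (p - 1)) • (InnerProductSpace.toDual ℝ _ (gradient H ξ))) ξ :=
    (hH.hasGradientAt hξ).hasFDerivAt.rpow_const (Or.inr hp.le)
  have h2 : HasGradientAt (fun ζ => H ζ ^ p) ((p * H ξ ^ (p - 1)) • gradient H ξ) ξ := by
    rw [hasGradientAt_iff_hasFDerivAt, map_smulₛₗ]
    exact h1
  rw [anisotropicField, h2.gradient, smul_smul]
  congr 1
  field_simp

/-- $H$ itself need not be differentiable at the origin, but $H^p=O(|\xi|^p)=o(|\xi|)$ since $p>1$.
-/
lemma anisotropicField_zero (hH : IsAnisotropy H) {p : ℝ} (hp : 1 < p) :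
    anisotropicField p H 0 = 0 := by
  obtain ⟨c, C, hc, hC, hb⟩ := hH.exists_bounds
  have h2 : HasGradientAt (fun ζ => H ζ ^ p) 0 0 := by
    rw [hasGradientAt_iff_isLittleO]
    simp only [hH.map_zero, inner_zero_left, sub_zero]
    rw [Real.zero_rpow (by linarith)]
    simp only [sub_zero]
    have : (fun x : EuclideanSpace ℝ (Fin n) => H x ^ p) =O[𝓝 0] fun x => ‖x‖ ^ p := by
      refine Asymptotics.IsBigO.of_bound (C ^ p) (Eventually.of_forall fun x => ?_)
      rw [Real.norm_of_nonneg (Real.rpow_nonneg (hH.nonneg x) _),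
        Real.norm_of_nonneg (by positivity), ← Real.mul_rpow hC.le (norm_nonneg _)]
      exact Real.rpow_le_rpow (hH.nonneg x) (hb x).2 (by linarith)
    refine this.trans_isLittleO ?_
    rw [← Asymptotics.isLittleO_norm_right]
    have hlim : Tendsto (fun x : EuclideanSpace ℝ (Fin n) => ‖x‖ ^ (p - 1)) (𝓝 0) (𝓝 0) := by
      have : Continuous fun x : EuclideanSpace ℝ (Fin n) => ‖x‖ ^ (p - 1) :=
        continuous_norm.rpow_const (fun _ => Or.inr (by linarith))
      have := this.tendsto 0
      simpa [Real.zero_rpow (show p - 1 ≠ 0 by linarith)] using this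
    have := (Asymptotics.isLittleO_one_iff ℝ).2 hlim
    have h3 := this.mul_isBigO (Asymptotics.isBigO_refl
      (fun x : EuclideanSpace ℝ (Fin n) => ‖x‖) (𝓝 0))
    refine h3.congr (fun x => ?_) (fun x => by simp)
    rcases eq_or_ne x 0 with rfl | hx
    · simp [Real.zero_rpow (show p ≠ 0 by linarith)]
    · rw [← Real.rpow_add_one (norm_ne_zero_iff.2 hx)]
      simp
  rw [anisotropicField, h2.gradient, smul_zero]

lemma inner_anisotropicField_self (hH : IsAnisotropy H) {p : ℝ} (hp : 1 < p)
    (ξ : EuclideanSpace ℝ (Fin n)) : inner ℝ (anisotropicField p H ξ) ξ = H ξ ^ (p - 1) * H ξ := by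
  rcases eq_or_ne ξ 0 with rfl | hξ
  · simp [hH.map_zero]
  · rw [hH.anisotropicField_of_ne_zero hp hξ, real_inner_smul_left, hH.inner_gradient_self hξ]

lemma inner_anisotropicField_le (hH : IsAnisotropy H) {p : ℝ} (hp : 1 < p)
    (ξ η : EuclideanSpace ℝ (Fin n)) :
    inner ℝ (anisotropicField p H ξ) η ≤ H ξ ^ (p - 1) * H η := by
  rcases eq_or_ne ξ 0 with rfl | hξ
  · rw [hH.anisotropicField_zero hp, inner_zero_left]
    exact mul_nonneg (Real.rpow_nonneg (hH.nonneg _) _) (hH.nonneg _)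
  · rw [hH.anisotropicField_of_ne_zero hp hξ, real_inner_smul_left]
    exact mul_le_mul_of_nonneg_left (hH.inner_gradient_le hξ η) (Real.rpow_nonneg (hH.nonneg _) _)

/-- The vector field `a` is monotone. -/
lemma inner_anisotropicField_sub_nonneg (hH : IsAnisotropy H) {p : ℝ} (hp : 1 < p)
    (ξ η : EuclideanSpace ℝ (Fin n)) :
    0 ≤ inner ℝ (anisotropicField p H ξ - anisotropicField p H η) (ξ - η) := by
  rw [inner_sub_left, inner_sub_right, inner_sub_right, hH.inner_anisotropicField_self hp,
    hH.inner_anisotropicField_self hp]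
  have h1 := hH.inner_anisotropicField_le hp ξ η
  have h2 := hH.inner_anisotropicField_le hp η ξ
  -- After both cross terms are bounded by `inner_anisotropicField_le`, what remains is monotonicity
  -- of $t\mapsto t^{p-1}$.
  have h3 : 0 ≤ (H ξ ^ (p - 1) - H η ^ (p - 1)) * (H ξ - H η) := by
    rcases le_total (H ξ) (H η) with h | h
    · exact mul_nonneg_of_nonpos_of_nonpos
        (sub_nonpos.2 (Real.rpow_le_rpow (hH.nonneg _) h (by linarith))) (sub_nonpos.2 h)
    · exact mul_nonneg
        (sub_nonneg.2 (Real.rpow_le_rpow (hH.nonneg _) h (by linarith))) (sub_nonneg.2 h)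
  nlinarith

lemma exists_norm_anisotropicField_le (hH : IsAnisotropy H) {p : ℝ} (hp : 1 < p) :
    ∃ C : ℝ, 0 < C ∧ ∀ ξ, ‖anisotropicField p H ξ‖ ≤ C * ‖ξ‖ ^ (p - 1) := by
  obtain ⟨c, C, hc, hC, hb⟩ := hH.exists_bounds
  refine ⟨C ^ (p - 1) * C, by positivity, fun ξ => ?_⟩
  set A := anisotropicField p H ξ
  -- Duality: test the field against itself.
  have h1 := hH.inner_anisotropicField_le hp ξ A
  rw [real_inner_self_eq_norm_sq] at h1
  have h2 : H ξ ^ (p - 1) * H A ≤ (C * ‖ξ‖) ^ (p - 1) * (C * ‖A‖) :=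
    mul_le_mul (Real.rpow_le_rpow (hH.nonneg _) (hb ξ).2 (by linarith)) (hb A).2 (hH.nonneg _)
      (by positivity)
  rw [Real.mul_rpow hC.le (norm_nonneg _)] at h2
  rcases (norm_nonneg A).eq_or_lt with h0 | h0
  · rw [← h0]
    positivity
  · refine le_of_mul_le_mul_right ?_ h0
    nlinarith

lemma continuous_anisotropicField (hH : IsAnisotropy H) {p : ℝ} (hp : 1 < p) :
    Continuous (anisotropicField p H) := by
  rw [continuous_iff_continuousAt]
  intro ξ
  rcases eq_or_ne ξ 0 with rfl | hξ
  · obtain ⟨C, hC, hb⟩ := hH.exists_norm_anisotropicField_le hp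
    rw [ContinuousAt, hH.anisotropicField_zero hp]
    refine squeeze_zero_norm hb ?_
    have : Continuous fun x : EuclideanSpace ℝ (Fin n) => C * ‖x‖ ^ (p - 1) :=
      continuous_const.mul (continuous_norm.rpow_const (fun _ => Or.inr (by linarith)))
    have := this.tendsto 0
    simpa [Real.zero_rpow (show p - 1 ≠ 0 by linarith)] using this
  · have h1 : ContinuousAt (fun ξ => H ξ ^ (p - 1) • gradient H ξ) ξ := by
      refine ContinuousAt.smul (hH.continuous.continuousAt.rpow_const (Or.inr (by linarith))) ?_
      have h2 : ContinuousAt (fderiv ℝ H) ξ :=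
        (hH.contDiffAt hξ).continuousAt_fderiv (by norm_num)
      exact (InnerProductSpace.toDual ℝ _).symm.continuous.continuousAt.comp h2
    refine h1.congr ?_
    filter_upwards [isOpen_compl_singleton.mem_nhds hξ] with ζ hζ
    exact (hH.anisotropicField_of_ne_zero hp hζ).symm

lemma anisotropicField_smul (hH : IsAnisotropy H) {p : ℝ} (hp : 1 < p) {t : ℝ} (ht : 0 ≤ t)
    (ξ : EuclideanSpace ℝ (Fin n)) :
    anisotropicField p H (t • ξ) = t ^ (p - 1) • anisotropicField p H ξ := by
  rcases ht.eq_or_lt with rfl | ht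
  · simp [hH.anisotropicField_zero hp, Real.zero_rpow (show p - 1 ≠ 0 by linarith)]
  rcases eq_or_ne ξ 0 with rfl | hξ
  · simp [hH.anisotropicField_zero hp]
  have htξ : t • ξ ≠ 0 := smul_ne_zero ht.ne' hξ
  -- $\nabla H$ is homogeneous of degree zero; this is seen by differentiating in the direction
  -- $t\eta$.
  have hg : gradient H (t • ξ) = gradient H ξ := by
    refine ext_inner_right ℝ fun η => ?_
    have h1 := hH.hasDerivAt_line htξ (t • η)
    have h2 := (hH.hasDerivAt_line hξ η).const_mul t
    have h3 : (fun s : ℝ => H (t • ξ + s • t • η)) = fun s => t * H (ξ + s • η) := by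
      funext s
      rw [← hH.map_smul ht.le, smul_add, smul_comm s t]
    rw [h3] at h1
    have h4 := h1.unique h2
    rw [inner_smul_right] at h4
    exact mul_left_cancel₀ ht.ne' h4
  rw [hH.anisotropicField_of_ne_zero hp hξ, hH.anisotropicField_of_ne_zero hp htξ, hg,
    hH.map_smul ht.le, Real.mul_rpow ht.le (hH.nonneg _), smul_smul]

end IsAnisotropy

/-! ### The dual gauge, its gradient and its duality with $a$. -/

/-- `e x` minimises the linear functional `⟪x, ·⟫` over the unit ball `{H ≤ 1}`. -/
def IsSupportMap {n : ℕ} (H : EuclideanSpace ℝ (Fin n) → ℝ)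
    (e : EuclideanSpace ℝ (Fin n) → EuclideanSpace ℝ (Fin n)) : Prop :=
  ∀ x, H (e x) ≤ 1 ∧ ∀ η, H η ≤ 1 → inner ℝ x (e x) ≤ inner ℝ x η

/-- The dual gauge attached to a support map. -/
noncomputable def dualGauge {n : ℕ} (e : EuclideanSpace ℝ (Fin n) → EuclideanSpace ℝ (Fin n))
    (x : EuclideanSpace ℝ (Fin n)) : ℝ := -inner ℝ x (e x)

lemma IsAnisotropy.exists_supportMap {n : ℕ} {H : EuclideanSpace ℝ (Fin n) → ℝ}
    (hH : IsAnisotropy H) : ∃ e, IsSupportMap H e := by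
  obtain ⟨c, C, hc, hC, hb⟩ := hH.exists_bounds
  have hK : IsCompact {ξ | H ξ ≤ 1} := by
    refine (isCompact_closedBall (0 : EuclideanSpace ℝ (Fin n)) (1 / c)).of_isClosed_subset
      (isClosed_le hH.continuous continuous_const) fun ξ hξ => ?_
    have hξ : H ξ ≤ 1 := hξ
    rw [mem_closedBall_zero_iff, le_div_iff₀ hc]
    linarith [(hb ξ).1]
  have hne : {ξ | H ξ ≤ 1}.Nonempty := ⟨0, by simp [hH.map_zero]⟩
  have : ∀ x : EuclideanSpace ℝ (Fin n), ∃ e, H e ≤ 1 ∧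
      ∀ η, H η ≤ 1 → inner ℝ x e ≤ inner ℝ x η := by
    intro x
    obtain ⟨e, he, hm⟩ := hK.exists_isMinOn hne
      (f := fun η => inner ℝ x η) (by fun_prop)
    exact ⟨e, he, fun η hη => hm hη⟩
  choose e he using this
  exact ⟨e, he⟩

namespace IsSupportMap

variable {n : ℕ} {H : EuclideanSpace ℝ (Fin n) → ℝ}
  {e : EuclideanSpace ℝ (Fin n) → EuclideanSpace ℝ (Fin n)}

lemma exists_norm_le (he : IsSupportMap H e) (hH : IsAnisotropy H) :
    ∃ C : ℝ, 0 < C ∧ ∀ x, ‖e x‖ ≤ C := by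
  obtain ⟨c, C, hc, hC, hb⟩ := hH.exists_bounds
  refine ⟨1 / c, by positivity, fun x => ?_⟩
  rw [le_div_iff₀ hc]
  linarith [(hb (e x)).1, (he x).1]

lemma neg_inner_le (he : IsSupportMap H e) (hH : IsAnisotropy H)
    (x η : EuclideanSpace ℝ (Fin n)) : -inner ℝ x η ≤ dualGauge e x * H η := by
  rcases eq_or_ne η 0 with rfl | hη
  · simp [hH.map_zero]
  have h0 := hH.pos_of_ne_zero hη
  have h1 := (he x).2 ((H η)⁻¹ • η) (by
    rw [hH.map_smul (inv_nonneg.2 h0.le), inv_mul_cancel₀ h0.ne'])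
  rw [inner_smul_right, inv_mul_eq_div, le_div_iff₀ h0] at h1
  rw [dualGauge]
  linarith

lemma neg_inner_le_of_le_one (he : IsSupportMap H e)
    (x : EuclideanSpace ℝ (Fin n)) {η : EuclideanSpace ℝ (Fin n)} (hη : H η ≤ 1) :
    -inner ℝ x η ≤ dualGauge e x :=
  neg_le_neg ((he x).2 η hη)

lemma dualGauge_zero : dualGauge e 0 = 0 := by simp [dualGauge]

lemma dualGauge_nonneg (he : IsSupportMap H e) (hH : IsAnisotropy H)
    (x : EuclideanSpace ℝ (Fin n)) : 0 ≤ dualGauge e x := by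
  simpa using he.neg_inner_le_of_le_one x (η := 0) (by simp [hH.map_zero])

lemma dualGauge_smul (he : IsSupportMap H e) {t : ℝ} (ht : 0 ≤ t)
    (x : EuclideanSpace ℝ (Fin n)) : dualGauge e (t • x) = t * dualGauge e x := by
  apply le_antisymm
  · have h1 := he.neg_inner_le_of_le_one x (he (t • x)).1
    have h2 : dualGauge e (t • x) = t * -inner ℝ x (e (t • x)) := by
      rw [dualGauge, real_inner_smul_left, mul_neg]
    rw [h2]
    exact mul_le_mul_of_nonneg_left h1 ht
  · have h1 := he.neg_inner_le_of_le_one (t • x) (he x).1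
    rw [real_inner_smul_left] at h1
    rw [dualGauge, mul_neg]
    exact h1

lemma exists_le_dualGauge (he : IsSupportMap H e) (hH : IsAnisotropy H) :
    ∃ c : ℝ, 0 < c ∧ ∀ x, c * ‖x‖ ≤ dualGauge e x := by
  obtain ⟨c, C, hc, hC, hb⟩ := hH.exists_bounds
  refine ⟨1 / C, by positivity, fun x => ?_⟩
  have h1 := he.neg_inner_le hH x (-x)
  rw [inner_neg_right, neg_neg, real_inner_self_eq_norm_sq] at h1
  have h2 := (hb (-x)).2
  rw [norm_neg] at h2
  have h3 := mul_le_mul_of_nonneg_left h2 (he.dualGauge_nonneg hH x)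
  rcases (norm_nonneg x).eq_or_lt with h0 | h0
  · rw [← h0, mul_zero]
    exact he.dualGauge_nonneg hH x
  · rw [one_div, inv_mul_le_iff₀ hC]
    refine le_of_mul_le_mul_right ?_ h0
    nlinarith

lemma dualGauge_pos (he : IsSupportMap H e) (hH : IsAnisotropy H)
    {x : EuclideanSpace ℝ (Fin n)} (hx : x ≠ 0) : 0 < dualGauge e x := by
  obtain ⟨c, hc, h⟩ := he.exists_le_dualGauge hH
  exact (mul_pos hc (norm_pos_iff.2 hx)).trans_le (h x)

/-- The vector $e(y)$ is a competitor in the problem that defines the gauge at $x$. -/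
lemma sub_le_inner (he : IsSupportMap H e) (x y : EuclideanSpace ℝ (Fin n)) :
    dualGauge e y - dualGauge e x ≤ -inner ℝ (y - x) (e y) := by
  have := he.neg_inner_le_of_le_one x (he y).1
  rw [inner_sub_left]
  simp only [dualGauge] at this ⊢
  linarith

lemma exists_lipschitz (he : IsSupportMap H e) (hH : IsAnisotropy H) :
    ∃ C : ℝ, 0 < C ∧ ∀ x y, |dualGauge e x - dualGauge e y| ≤ C * ‖x - y‖ := by
  obtain ⟨C, hC, hb⟩ := he.exists_norm_le hH
  have key : ∀ x y, dualGauge e x - dualGauge e y ≤ C * ‖x - y‖ := by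
    intro x y
    have h1 := he.sub_le_inner y x
    have h2 := abs_le.1 (abs_real_inner_le_norm (x - y) (e x))
    have h3 := mul_le_mul_of_nonneg_left (hb x) (norm_nonneg (x - y))
    linarith [h2.1]
  refine ⟨C, hC, fun x y => abs_le.2 ⟨?_, key x y⟩⟩
  have := key y x
  rw [norm_sub_rev] at this
  linarith

lemma continuous_dualGauge (he : IsSupportMap H e) (hH : IsAnisotropy H) :
    Continuous (dualGauge e) := by
  obtain ⟨C, hC, h⟩ := he.exists_lipschitz hH
  exact (LipschitzWith.of_dist_le_mul (K := ⟨C, hC.le⟩) fun x y => by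
    rw [Real.dist_eq, dist_eq_norm]
    exact h x y).continuous

lemma map_eq_one (he : IsSupportMap H e) (hH : IsAnisotropy H)
    {x : EuclideanSpace ℝ (Fin n)} (hx : x ≠ 0) : H (e x) = 1 := by
  refine le_antisymm (he x).1 ?_
  have h1 := he.neg_inner_le hH x (e x)
  exact le_of_mul_le_mul_left (by rw [mul_one]; exact h1) (he.dualGauge_pos hH hx)

lemma ne_zero (he : IsSupportMap H e) (hH : IsAnisotropy H)
    {x : EuclideanSpace ℝ (Fin n)} (hx : x ≠ 0) : e x ≠ 0 := by
  intro h
  have := he.map_eq_one hH hx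
  rw [h, hH.map_zero] at this
  exact zero_ne_one this

/-- Lagrange multipliers: $\eta\mapsto N(x)H(\eta)+\langle x,\eta\rangle$ is nonnegative everywhere
and vanishes at $e(x)$, so its derivative there is zero. -/
lemma gradient_eq (he : IsSupportMap H e) (hH : IsAnisotropy H)
    {x : EuclideanSpace ℝ (Fin n)} (hx : x ≠ 0) :
    gradient H (e x) = -(dualGauge e x)⁻¹ • x := by
  have hN := he.dualGauge_pos hH hx
  refine ext_inner_right ℝ fun η => ?_
  have h1 := (hH.hasDerivAt_line (he.ne_zero hH hx) η).const_mul (dualGauge e x)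
  have h2 : HasDerivAt (fun t : ℝ => inner ℝ x (e x + t • η)) (inner ℝ x η) 0 := by
    simp only [inner_add_right, inner_smul_right]
    simpa using ((hasDerivAt_id (0 : ℝ)).mul_const (inner ℝ x η)).const_add (inner ℝ x (e x))
  have h3 := h1.add h2
  have hmin : IsLocalMin ((fun t : ℝ => dualGauge e x * H (e x + t • η)) +
      fun t : ℝ => inner ℝ x (e x + t • η)) 0 := by
    refine Eventually.of_forall fun t => ?_
    have := he.neg_inner_le hH x (e x + t • η)
    simp only [Pi.add_apply, zero_smul, add_zero, he.map_eq_one hH hx]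
    simp only [dualGauge] at this ⊢
    linarith
  have h4 := hmin.hasDerivAt_eq_zero h3
  rw [real_inner_smul_left]
  field_simp
  linarith

/-- If $|e(x)-e(y)|\ge\varepsilon$, the midpoint can be pushed by $\delta$ in the direction $-x$
without leaving the ball, which lowers $\langle x,\cdot\rangle$ by $\delta|x|$. For $y$ near $x$ the
vector $e(y)$ almost minimises $\langle x,\cdot\rangle$, so this would go below the minimum. -/
lemma continuousAt (he : IsSupportMap H e) (hH : IsAnisotropy H)
    {x : EuclideanSpace ℝ (Fin n)} (hx : x ≠ 0) : ContinuousAt e x := by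
  obtain ⟨C, hC, hb⟩ := he.exists_norm_le hH
  obtain ⟨L, hL, hlip⟩ := he.exists_lipschitz hH
  rw [Metric.continuousAt_iff]
  intro ε hε
  obtain ⟨δ, hδ, h⟩ := hH.uniformlyConvex_closedBall hε
  have hx0 : 0 < ‖x‖ := norm_pos_iff.2 hx
  refine ⟨2 * δ * ‖x‖ / (C + L), by positivity, fun {y} hy => ?_⟩
  by_contra! hle
  rw [dist_comm] at hle
  have h1 := h (e x) (e y) (he x).1 (he y).1 hle
    (midpoint ℝ (e x) (e y) - (δ / ‖x‖) • x) (by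
      rw [dist_eq_norm, sub_sub_cancel_left, norm_neg, norm_smul,
        Real.norm_of_nonneg (by positivity)]
      field_simp
      rfl)
  have h2 := he.neg_inner_le_of_le_one x h1
  rw [inner_sub_right, inner_smul_right, real_inner_self_eq_norm_sq, midpoint_eq_smul_add,
    inner_smul_right, inner_add_right] at h2
  have h3 : δ / ‖x‖ * ‖x‖ ^ 2 = δ * ‖x‖ := by field_simp
  rw [h3] at h2
  have h4 := abs_le.1 (abs_real_inner_le_norm (y - x) (e y))
  have h5 := mul_le_mul_of_nonneg_left (hb y) (norm_nonneg (y - x))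
  have h6 := abs_le.1 (hlip y x)
  rw [inner_sub_left] at h4
  rw [dist_eq_norm, lt_div_iff₀ (by positivity)] at hy
  simp only [dualGauge, invOf_eq_inv] at h2 h6
  nlinarith [h4.1, h4.2, h6.1, h6.2]

/-- Testing with $e(x)$ at $y$ and with $e(y)$ at $x$ places the first-order remainder between $0$
and $-\langle y-x,e(y)-e(x)\rangle$; continuity of $e$ makes it $o(|y-x|)$. -/
lemma hasGradientAt_dualGauge (he : IsSupportMap H e) (hH : IsAnisotropy H)
    {x : EuclideanSpace ℝ (Fin n)} (hx : x ≠ 0) : HasGradientAt (dualGauge e) (-e x) x := by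
  rw [hasGradientAt_iff_isLittleO, Asymptotics.isLittleO_iff]
  intro c hc
  have hev := Metric.tendsto_nhds.1 (he.continuousAt hH hx) c hc
  filter_upwards [hev] with y hy
  have h1 := he.sub_le_inner x y
  have h2 := he.neg_inner_le_of_le_one y (he x).1
  have h3 := abs_le.1 (abs_real_inner_le_norm (y - x) (e y - e x))
  rw [dist_eq_norm] at hy
  have h4 := mul_le_mul_of_nonneg_left hy.le (norm_nonneg (y - x))
  rw [Real.norm_eq_abs, inner_neg_left, abs_le]
  rw [inner_sub_right] at h3
  have h5 : inner ℝ (e x) (y - x) = inner ℝ (y - x) (e x) := real_inner_comm _ _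
  have h6 : inner ℝ (y - x) (e x) = inner ℝ y (e x) - inner ℝ x (e x) := inner_sub_left _ _ _
  rw [h5]
  simp only [dualGauge] at h1 h2 ⊢
  constructor
  · nlinarith [h3.1, h3.2, norm_nonneg (y - x)]
  · nlinarith [h3.1, h3.2]

/-- This duality is why $N$ is the right radial variable: functions of $N$ with slope along $e$ have
flux parallel to $x$. -/
lemma anisotropicField_eq (he : IsSupportMap H e) (hH : IsAnisotropy H) {p : ℝ} (hp : 1 < p)
    {x : EuclideanSpace ℝ (Fin n)} (hx : x ≠ 0) :
    anisotropicField p H (e x) = -(dualGauge e x)⁻¹ • x := by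
  rw [hH.anisotropicField_of_ne_zero hp (he.ne_zero hH hx), he.map_eq_one hH hx,
    he.gradient_eq hH hx, Real.one_rpow, one_smul]

end IsSupportMap

/-! ### A radial vector field with prescribed weak divergence. -/

section RadialField

variable {n : ℕ}

lemma gradient_eq_zero_of_notMem_tsupport {φ : EuclideanSpace ℝ (Fin n) → ℝ}
    {x : EuclideanSpace ℝ (Fin n)} (hx : x ∉ tsupport φ) : gradient φ x = 0 := by
  have h : fderiv ℝ φ x = 0 := by
    by_contra hne
    exact hx (support_fderiv_subset ℝ hne)
  rw [gradient, h, map_zero]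

lemma hasGradientAt_of_contDiff {φ : EuclideanSpace ℝ (Fin n) → ℝ} (hφ : ContDiff ℝ 1 φ)
    (x : EuclideanSpace ℝ (Fin n)) : HasGradientAt φ (gradient φ x) x :=
  (hφ.differentiable (by norm_num) x).hasGradientAt

lemma continuous_gradient {φ : EuclideanSpace ℝ (Fin n) → ℝ} (hφ : ContDiff ℝ 1 φ) :
    Continuous (gradient φ) :=
  (InnerProductSpace.toDual ℝ _).symm.continuous.comp (hφ.continuous_fderiv (by norm_num))

lemma continuous_integral_mul_of_hasCompactSupport {G ψ : EuclideanSpace ℝ (Fin n) → ℝ}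
    (hG : Continuous G) (hψ : Continuous ψ) (hc : HasCompactSupport ψ) :
    Continuous fun σ : ℝ => ∫ x, G (σ • x) * ψ x := by
  have h1 : ∀ σ : ℝ, ∫ x, G (σ • x) * ψ x = ∫ x in tsupport ψ, G (σ • x) * ψ x := by
    intro σ
    refine (setIntegral_eq_integral_of_forall_compl_eq_zero fun x hx => ?_).symm
    rw [image_eq_zero_of_notMem_tsupport hx, mul_zero]
  simp_rw [h1]
  exact continuous_parametric_integral_of_continuous (by fun_prop) hc

/-- Derivative of the dilation `σ ↦ ∫ G(y) φ(y/σ) dy`. -/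
lemma hasDerivAt_integral_dilation {G φ : EuclideanSpace ℝ (Fin n) → ℝ} (hG : Continuous G)
    (hφ : ContDiff ℝ 1 φ) (hc : HasCompactSupport φ) {s : ℝ} (hs : 0 < s) :
    HasDerivAt (fun σ : ℝ => ∫ y, G y * φ (σ⁻¹ • y))
      (∫ y, G y * (-(s ^ 2)⁻¹ * inner ℝ y (gradient φ (s⁻¹ • y)))) s := by
  obtain ⟨R, hR⟩ := hc.isCompact.isBounded.subset_closedBall (0 : EuclideanSpace ℝ (Fin n))
  have hgc := continuous_gradient hφ
  -- This ball contains the supports of all the dilates with $\sigma<2s$, so a single bound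
  -- dominates the derivatives.
  set B := Metric.closedBall (0 : EuclideanSpace ℝ (Fin n)) (2 * s * R)
  have hB : IsCompact B := isCompact_closedBall _ _
  have hout : ∀ σ ∈ Ioo (s / 2) (2 * s), ∀ y ∉ B, σ⁻¹ • y ∉ tsupport φ := by
    intro σ hσ y hy hmem
    have hσ0 : 0 < σ := by linarith [hσ.1]
    have h1 := hR hmem
    rw [mem_closedBall_zero_iff, norm_smul, norm_inv, Real.norm_of_nonneg hσ0.le,
      inv_mul_le_iff₀ hσ0] at h1
    refine hy ?_
    rw [mem_closedBall_zero_iff]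
    have hR0 : 0 ≤ R := by
      by_contra! hneg
      nlinarith [norm_nonneg y]
    nlinarith [hσ.2]
  set F' : ℝ → EuclideanSpace ℝ (Fin n) → ℝ := fun σ y =>
    G y * (-(σ ^ 2)⁻¹ * inner ℝ y (gradient φ (σ⁻¹ • y)))
  have hF'c : ContinuousOn (Function.uncurry F') (Icc (s / 2) (2 * s) ×ˢ B) := by
    have : ∀ q ∈ Icc (s / 2) (2 * s) ×ˢ B, q.1 ≠ 0 := fun q hq => by
      have := hq.1.1
      linarith
    have hinv : ContinuousOn (fun q : ℝ × EuclideanSpace ℝ (Fin n) => q.1⁻¹ • q.2)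
        (Icc (s / 2) (2 * s) ×ˢ B) :=
      (continuous_fst.continuousOn.inv₀ this).smul continuous_snd.continuousOn
    refine (hG.comp continuous_snd).continuousOn.mul (ContinuousOn.mul ?_ ?_)
    · exact ((continuous_fst.pow 2).continuousOn.inv₀ fun q hq => pow_ne_zero 2 (this q hq)).neg
    · exact continuous_snd.continuousOn.inner (hgc.comp_continuousOn hinv)
  obtain ⟨M, hM⟩ := (isCompact_Icc.prod hB).exists_bound_of_continuousOn hF'c
  have hnhds : Ioo (s / 2) (2 * s) ∈ 𝓝 s := Ioo_mem_nhds (by linarith) (by linarith)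
  have hcs : ∀ σ ∈ Ioo (s / 2) (2 * s), Integrable fun y => G y * φ (σ⁻¹ • y) := by
    intro σ hσ
    refine Continuous.integrable_of_hasCompactSupport (by have := hφ.continuous; fun_prop) ?_
    refine HasCompactSupport.intro hB fun y hy => ?_
    rw [image_eq_zero_of_notMem_tsupport (hout σ hσ y hy), mul_zero]
  refine (hasDerivAt_integral_of_dominated_loc_of_deriv_le (F' := F')
    (bound := B.indicator fun _ => M) hnhds ?_ (hcs s ⟨by linarith, by linarith⟩) ?_ ?_ ?_ ?_).2
  · filter_upwards [hnhds] with σ hσ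
    exact (hcs σ hσ).aestronglyMeasurable
  · exact Continuous.aestronglyMeasurable (by fun_prop)
  · refine Eventually.of_forall fun y σ hσ => ?_
    by_cases hy : y ∈ B
    · rw [indicator_of_mem hy]
      exact hM (σ, y) ⟨⟨hσ.1.le, hσ.2.le⟩, hy⟩
    · rw [indicator_of_notMem hy]
      simp only [F', gradient_eq_zero_of_notMem_tsupport (hout σ hσ y hy), inner_zero_right,
        mul_zero, norm_zero, le_refl]
  · rw [integrable_indicator_iff hB.measurableSet]
    exact integrableOn_const hB.measure_lt_top.ne
  · refine Eventually.of_forall fun y σ hσ => HasDerivAt.const_mul _ ?_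
    have hσ0 : σ ≠ 0 := by linarith [hσ.1]
    have h1 : HasDerivAt (fun τ : ℝ => τ⁻¹ • y) ((-(σ ^ 2)⁻¹) • y) σ :=
      (hasDerivAt_inv hσ0).smul_const y
    have h2 := (hasGradientAt_of_contDiff hφ (σ⁻¹ • y)).hasFDerivAt.comp_hasDerivAt σ h1
    rw [InnerProductSpace.toDual_apply_apply, inner_smul_right, real_inner_comm] at h2
    exact h2

/-- The vector field `x ↦ x ∫₀¹ σⁿ⁻¹ G(σx) dσ` has weak divergence `G`. -/
lemma integral_radialField_inner_gradient (hn : 0 < n) {G φ : EuclideanSpace ℝ (Fin n) → ℝ}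
    (hG : Continuous G) (hφ : ContDiff ℝ 1 φ) (hc : HasCompactSupport φ) :
    ∫ x, (∫ σ in (0 : ℝ)..1, σ ^ (n - 1) * G (σ • x)) * inner ℝ x (gradient φ x)
      = -∫ x, G x * φ x := by
  set ψ : EuclideanSpace ℝ (Fin n) → ℝ := fun x => inner ℝ x (gradient φ x)
  have hψ : Continuous ψ := continuous_id.inner (continuous_gradient hφ)
  have hψz : ∀ x ∉ tsupport φ, ψ x = 0 := fun x hx => by
    simp only [ψ, gradient_eq_zero_of_notMem_tsupport hx, inner_zero_right]
  have hψc : HasCompactSupport ψ := HasCompactSupport.intro hc hψz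
  have hKc := continuous_integral_mul_of_hasCompactSupport hG hψ hψc
  have hJc := continuous_integral_mul_of_hasCompactSupport hG hφ.continuous hc
  have hdil : ∀ F : EuclideanSpace ℝ (Fin n) → ℝ, ∀ s : ℝ, 0 < s →
      ∫ y, F y = s ^ n * ∫ x, F (s • x) := by
    intro F s hs
    rw [Measure.integral_comp_smul, finrank_euclideanSpace_fin, abs_of_pos (by positivity),
      smul_eq_mul, mul_inv_cancel_left₀ (by positivity)]
  -- As $G$ is only continuous, the dilation is moved onto $\varphi$: $\sigma^n\int G(\sigma
  -- x)\varphi(x)\,dx=\int G(y)\varphi(y/\sigma)\,dy$. Integrating the $\sigma$-derivative over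
  -- $[0,1]$ and exchanging integrals gives the claim; the endpoint $0$ contributes nothing because
  -- $n>0$.
  have hder : ∀ s ∈ Ioo (0 : ℝ) 1, HasDerivWithinAt
      (fun σ : ℝ => σ ^ n * ∫ x, G (σ • x) * φ x)
      (-(s ^ (n - 1) * ∫ x, G (s • x) * ψ x)) (Ioi s) s := by
    intro s hs
    refine HasDerivAt.hasDerivWithinAt ?_
    have h := hasDerivAt_integral_dilation hG hφ hc hs.1
    have h2 : ∫ y, G y * (-(s ^ 2)⁻¹ * inner ℝ y (gradient φ (s⁻¹ • y)))
        = -(s ^ (n - 1) * ∫ x, G (s • x) * ψ x) := by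
      rw [hdil _ s hs.1, ← mul_neg, ← integral_neg, ← integral_const_mul, ← integral_const_mul]
      congr 1
      funext x
      have hs0 : s ≠ 0 := hs.1.ne'
      rw [inv_smul_smul₀ hs0, real_inner_smul_left]
      obtain ⟨k, rfl⟩ : ∃ k, n = k + 1 := ⟨n - 1, by omega⟩
      simp only [Nat.add_sub_cancel, ψ]
      field_simp
      ring
    rw [h2] at h
    refine h.congr_of_eventuallyEq ?_
    filter_upwards [lt_mem_nhds hs.1] with σ hσ
    rw [hdil (fun y => G y * φ (σ⁻¹ • y)) σ hσ]
    simp only [inv_smul_smul₀ hσ.ne']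
  have hFTC := intervalIntegral.integral_eq_sub_of_hasDeriv_right_of_le zero_le_one
    ((continuous_pow n).mul hJc).continuousOn hder
    (((continuous_pow (n - 1)).mul hKc).neg.intervalIntegrable _ _)
  rw [intervalIntegral.integral_neg] at hFTC
  simp only [Pi.mul_apply, one_pow, one_mul, one_smul, zero_pow hn.ne', zero_mul, sub_zero] at hFTC
  rw [← hFTC, neg_neg]
  have hint : Integrable (Function.uncurry
      fun (σ : ℝ) (x : EuclideanSpace ℝ (Fin n)) => σ ^ (n - 1) * (G (σ • x) * ψ x))
      ((volume.restrict (uIoc (0 : ℝ) 1)).prod volume) := by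
    have hcont : Continuous (Function.uncurry
        fun (σ : ℝ) (x : EuclideanSpace ℝ (Fin n)) => σ ^ (n - 1) * (G (σ • x) * ψ x)) := by
      fun_prop
    have h1 : IntegrableOn (Function.uncurry
        fun (σ : ℝ) (x : EuclideanSpace ℝ (Fin n)) => σ ^ (n - 1) * (G (σ • x) * ψ x))
        (Icc 0 1 ×ˢ tsupport φ) (volume.prod volume) :=
      hcont.continuousOn.integrableOn_compact (isCompact_Icc.prod hc)
    have h2 : IntegrableOn (Function.uncurry
        fun (σ : ℝ) (x : EuclideanSpace ℝ (Fin n)) => σ ^ (n - 1) * (G (σ • x) * ψ x))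
        (Icc 0 1 ×ˢ univ) (volume.prod volume) := by
      refine h1.of_forall_sdiff_eq_zero (measurableSet_Icc.prod MeasurableSet.univ) ?_
      rintro ⟨σ, x⟩ ⟨hx1, hx2⟩
      have : x ∉ tsupport φ := fun h => hx2 ⟨hx1.1, h⟩
      simp [hψz x this]
    rw [IntegrableOn, ← Measure.prod_restrict, Measure.restrict_univ] at h2
    refine h2.mono_measure (Measure.prod_mono ?_ le_rfl)
    rw [uIoc_of_le zero_le_one]
    exact Measure.restrict_mono Ioc_subset_Icc_self le_rfl
  have hswap := intervalIntegral_integral_swap hint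
  have h1 : ∫ σ in (0 : ℝ)..1, σ ^ (n - 1) * ∫ x, G (σ • x) * ψ x
      = ∫ σ in (0 : ℝ)..1, ∫ x, σ ^ (n - 1) * (G (σ • x) * ψ x) := by
    congr 1
    funext σ
    rw [integral_const_mul]
  rw [h1, hswap]
  congr 1
  funext x
  rw [← intervalIntegral.integral_mul_const]
  simp only [mul_assoc, ψ]

end RadialField

/-! ### Mollification in $L^p$. -/

section Mollification

variable {n : ℕ} {F : Type*} [NormedAddCommGroup F] [NormedSpace ℝ F]

/-- The mollification of `g` by the normalised bump function `φ`. -/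
noncomputable def mollify (φ : ContDiffBump (0 : EuclideanSpace ℝ (Fin n)))
    (g : EuclideanSpace ℝ (Fin n) → F) : EuclideanSpace ℝ (Fin n) → F :=
  φ.normed volume ⋆[ContinuousLinearMap.lsmul ℝ ℝ, volume] g

lemma mollify_apply (φ : ContDiffBump (0 : EuclideanSpace ℝ (Fin n)))
    (g : EuclideanSpace ℝ (Fin n) → F) (x : EuclideanSpace ℝ (Fin n)) :
    mollify φ g x = ∫ t, φ.normed volume t • g (x - t) := rfl

lemma mollify_congr (φ : ContDiffBump (0 : EuclideanSpace ℝ (Fin n)))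
    {g g' : EuclideanSpace ℝ (Fin n) → F} {x : EuclideanSpace ℝ (Fin n)}
    (h : ∀ y ∈ Metric.ball x φ.rOut, g y = g' y) : mollify φ g x = mollify φ g' x := by
  rw [mollify_apply, mollify_apply]
  congr 1
  funext t
  by_cases ht : t ∈ Function.support (φ.normed (volume : Measure (EuclideanSpace ℝ (Fin n))))
  · rw [φ.support_normed_eq, mem_ball_zero_iff] at ht
    rw [h (x - t) (by rwa [Metric.mem_ball, dist_eq_norm, sub_sub_cancel_left, norm_neg])]
  · rw [Function.notMem_support.1 ht, zero_smul, zero_smul]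

lemma continuous_mollify (φ : ContDiffBump (0 : EuclideanSpace ℝ (Fin n)))
    {g : EuclideanSpace ℝ (Fin n) → F} (hg : LocallyIntegrable g) :
    Continuous (mollify φ g) :=
  HasCompactSupport.continuous_convolution_left _ φ.hasCompactSupport_normed
    φ.continuous_normed hg

lemma contDiff_mollify (φ : ContDiffBump (0 : EuclideanSpace ℝ (Fin n)))
    {g : EuclideanSpace ℝ (Fin n) → F} (hg : LocallyIntegrable g) :
    ContDiff ℝ ∞ (mollify φ g) :=
  HasCompactSupport.contDiff_convolution_left _ φ.hasCompactSupport_normed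
    φ.contDiff_normed hg

lemma mollify_add (φ : ContDiffBump (0 : EuclideanSpace ℝ (Fin n)))
    {g g' : EuclideanSpace ℝ (Fin n) → F} (hg : LocallyIntegrable g)
    (hg' : LocallyIntegrable g') : mollify φ (g + g') = mollify φ g + mollify φ g' :=
  ConvolutionExists.distrib_add
    (HasCompactSupport.convolutionExists_left _ φ.hasCompactSupport_normed φ.continuous_normed hg)
    (HasCompactSupport.convolutionExists_left _ φ.hasCompactSupport_normed φ.continuous_normed hg')

/-- Jensen's inequality for averages against a bump function. -/
lemma enorm_mollify_rpow_le (φ : ContDiffBump (0 : EuclideanSpace ℝ (Fin n)))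
    {g : EuclideanSpace ℝ (Fin n) → F} (hg : AEStronglyMeasurable g volume) {p : ℝ} (hp : 1 ≤ p)
    (x : EuclideanSpace ℝ (Fin n)) :
    ‖mollify φ g x‖ₑ ^ p ≤ ∫⁻ t, ‖φ.normed volume t‖ₑ * ‖g (x - t)‖ₑ ^ p := by
  set w : EuclideanSpace ℝ (Fin n) → ENNReal := fun t => ‖φ.normed volume t‖ₑ
  have hw : Measurable w := φ.continuous_normed.measurable.enorm
  have hw1 : ∫⁻ t, w t = 1 := by
    have h1 : ∫⁻ t, w t = ENNReal.ofReal (∫ t, φ.normed volume t) := by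
      rw [ofReal_integral_eq_lintegral_ofReal φ.integrable_normed
        (Eventually.of_forall fun t => φ.nonneg_normed t)]
      exact lintegral_congr fun t => Real.enorm_of_nonneg (φ.nonneg_normed t)
    rw [h1, φ.integral_normed, ENNReal.ofReal_one]
  -- The bump has total mass one, so the inequality is monotonicity of $L^p$ norms for a probability
  -- measure.
  set ν := (volume : Measure (EuclideanSpace ℝ (Fin n))).withDensity w
  have : IsProbabilityMeasure ν := ⟨by rw [withDensity_apply _ MeasurableSet.univ,
    setLIntegral_univ, hw1]⟩
  have hgx : AEStronglyMeasurable (fun t => g (x - t)) volume :=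
    hg.comp_quasiMeasurePreserving (quasiMeasurePreserving_sub_left volume x)
  have hgν : AEStronglyMeasurable (fun t => g (x - t)) ν :=
    hgx.mono_ac (withDensity_absolutelyContinuous _ _)
  have h1 := eLpNorm'_le_eLpNorm'_of_exponent_le zero_lt_one hp ν hgν
  simp only [eLpNorm', ENNReal.rpow_one, div_one] at h1
  have hp0 : 0 < p := by linarith
  have h2 : (∫⁻ t, ‖g (x - t)‖ₑ ∂ν) ^ p ≤ ∫⁻ t, ‖g (x - t)‖ₑ ^ p ∂ν := by
    calc _ ≤ ((∫⁻ t, ‖g (x - t)‖ₑ ^ p ∂ν) ^ (1 / p)) ^ p := by gcongr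
      _ = _ := by rw [← ENNReal.rpow_mul, one_div_mul_cancel hp0.ne', ENNReal.rpow_one]
  rw [lintegral_withDensity_eq_lintegral_mul₀ hw.aemeasurable hgx.enorm,
    lintegral_withDensity_eq_lintegral_mul₀ hw.aemeasurable (hgx.enorm.pow_const p)] at h2
  refine le_trans ?_ h2
  gcongr
  rw [mollify_apply]
  refine (enorm_integral_le_lintegral_enorm _).trans (le_of_eq ?_)
  exact lintegral_congr fun t => enorm_smul _ _

/-- Mollification is a contraction of `L^p`. -/
lemma eLpNorm_mollify_le (φ : ContDiffBump (0 : EuclideanSpace ℝ (Fin n)))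
    {g : EuclideanSpace ℝ (Fin n) → F} (hg : AEStronglyMeasurable g volume) {p : ℝ}
    (hp : 1 ≤ p) :
    eLpNorm (mollify φ g) (ENNReal.ofReal p) volume ≤ eLpNorm g (ENNReal.ofReal p) volume := by
  have hp0 : 0 < p := by linarith
  have hP : ENNReal.ofReal p ≠ 0 := by simpa using hp0
  rw [eLpNorm_eq_lintegral_rpow_enorm_toReal hP ENNReal.ofReal_ne_top,
    eLpNorm_eq_lintegral_rpow_enorm_toReal hP ENNReal.ofReal_ne_top, ENNReal.toReal_ofReal hp0.le]
  gcongr 1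
  calc ∫⁻ x, ‖mollify φ g x‖ₑ ^ p
      ≤ ∫⁻ x, ∫⁻ t, ‖φ.normed volume t‖ₑ * ‖g (x - t)‖ₑ ^ p :=
        lintegral_mono fun x => enorm_mollify_rpow_le φ hg hp x
    _ = ∫⁻ t, ∫⁻ x, ‖φ.normed volume t‖ₑ * ‖g (x - t)‖ₑ ^ p := by
        refine lintegral_lintegral_swap ?_
        have h1 : AEStronglyMeasurable
            (fun q : EuclideanSpace ℝ (Fin n) × EuclideanSpace ℝ (Fin n) => g (q.1 - q.2))
            (volume.prod volume) :=
          hg.comp_quasiMeasurePreserving (quasiMeasurePreserving_sub _ _)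
        exact ((φ.continuous_normed.measurable.enorm.comp measurable_snd).aemeasurable).mul
          (h1.enorm.pow_const p)
    _ = ∫⁻ t, ‖φ.normed volume t‖ₑ * ∫⁻ x, ‖g x‖ₑ ^ p := by
        refine lintegral_congr fun t => ?_
        rw [lintegral_const_mul' _ _ enorm_ne_top,
          lintegral_sub_right_eq_self (fun x => ‖g x‖ₑ ^ p) t]
    _ = ∫⁻ x, ‖g x‖ₑ ^ p := by
        rw [lintegral_mul_const _ φ.continuous_normed.measurable.enorm]
        have h1 : ∫⁻ t, ‖φ.normed volume t‖ₑ = ENNReal.ofReal (∫ t, φ.normed volume t) := by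
          rw [ofReal_integral_eq_lintegral_ofReal φ.integrable_normed
            (Eventually.of_forall fun t => φ.nonneg_normed t)]
          exact lintegral_congr fun t => Real.enorm_of_nonneg (φ.nonneg_normed t)
        rw [h1, φ.integral_normed, ENNReal.ofReal_one, one_mul]

variable [CompleteSpace F]

/-- Uniform continuity makes the difference uniformly small, and for radii below 1 it vanishes off
the 1-thickening of the support, a set of finite measure. -/
lemma tendsto_eLpNorm_mollify_sub_of_continuous {ι : Type*} {l : Filter ι}
    {φ : ι → ContDiffBump (0 : EuclideanSpace ℝ (Fin n))}
    (hφ : Tendsto (fun i => (φ i).rOut) l (𝓝 0)) {h : EuclideanSpace ℝ (Fin n) → F}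
    (hh : Continuous h) (hc : HasCompactSupport h) {p : ℝ} (hp : 1 ≤ p) :
    Tendsto (fun i => eLpNorm (mollify (φ i) h - h) (ENNReal.ofReal p) volume) l (𝓝 0) := by
  have hp0 : 0 < p := by linarith
  set K := Metric.cthickening 1 (tsupport h)
  have hK : IsCompact K := hc.isCompact.cthickening
  have hV : (volume K) ^ (1 / p) ≠ ⊤ :=
    ENNReal.rpow_ne_top_of_nonneg (by positivity) hK.measure_lt_top.ne
  have key : ∀ ε : ℝ, 0 < ε → ∀ᶠ i in l,
      eLpNorm (mollify (φ i) h - h) (ENNReal.ofReal p) volume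
        ≤ (volume K) ^ (1 / p) * ENNReal.ofReal ε := by
    intro ε hε
    obtain ⟨δ, hδ, hu⟩ := Metric.uniformContinuous_iff.1
      (hc.uniformContinuous_of_continuous hh) ε hε
    filter_upwards [hφ.eventually (gt_mem_nhds (show 0 < min δ 1 by positivity))] with i hi
    have hpt : ∀ x, ‖(mollify (φ i) h - h) x‖ ≤ ‖K.indicator (fun _ => ε) x‖ := by
      intro x
      rw [Pi.sub_apply, ← dist_eq_norm]
      by_cases hx : x ∈ K
      · rw [indicator_of_mem hx, Real.norm_of_nonneg hε.le]
        refine (φ i).dist_normed_convolution_le hh.aestronglyMeasurable fun y hy => ?_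
        exact (hu ((Metric.mem_ball.1 hy).trans (hi.trans_le (min_le_left _ _)))).le
      · rw [indicator_of_notMem hx, norm_zero]
        refine (φ i).dist_normed_convolution_le hh.aestronglyMeasurable fun y hy => ?_
        have hx0 : ∀ z, dist z x < 1 → h z = 0 := by
          intro z hz
          by_contra hne
          refine hx (Metric.mem_cthickening_of_dist_le x z 1 _ (subset_tsupport h hne) ?_)
          rw [dist_comm]
          exact hz.le
        rw [hx0 y ((Metric.mem_ball.1 hy).trans (hi.trans_le (min_le_right _ _))),
          hx0 x (by simp), dist_self]
    refine (eLpNorm_mono hpt).trans ?_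
    rw [eLpNorm_indicator_const hK.measurableSet (by simpa using hp0) ENNReal.ofReal_ne_top,
      ENNReal.toReal_ofReal hp0.le, Real.enorm_of_nonneg hε.le, mul_comm]
  rw [ENNReal.tendsto_nhds_zero]
  intro ε hε
  rcases eq_or_ne ε ⊤ with rfl | hεt
  · exact Eventually.of_forall fun _ => le_top
  set V := (volume K) ^ (1 / p)
  have hV1 : 0 < V.toReal + 1 := by positivity
  have hε' : 0 < ε.toReal := ENNReal.toReal_pos hε.ne' hεt
  filter_upwards [key (ε.toReal / (V.toReal + 1)) (by positivity)] with i hi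
  refine hi.trans ?_
  calc V * ENNReal.ofReal (ε.toReal / (V.toReal + 1))
      = ENNReal.ofReal (V.toReal * (ε.toReal / (V.toReal + 1))) := by
        rw [ENNReal.ofReal_mul ENNReal.toReal_nonneg, ENNReal.ofReal_toReal hV]
    _ ≤ ENNReal.ofReal ε.toReal := by
        refine ENNReal.ofReal_le_ofReal ?_
        rw [mul_div_assoc', div_le_iff₀ hV1]
        nlinarith
    _ = ε := ENNReal.ofReal_toReal hεt

/-- Mollifications converge in `L^p`. -/
lemma tendsto_eLpNorm_mollify_sub {ι : Type*} {l : Filter ι}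
    {φ : ι → ContDiffBump (0 : EuclideanSpace ℝ (Fin n))}
    (hφ : Tendsto (fun i => (φ i).rOut) l (𝓝 0)) {p : ℝ} (hp : 1 ≤ p)
    {g : EuclideanSpace ℝ (Fin n) → F} (hg : MemLp g (ENNReal.ofReal p) volume) :
    Tendsto (fun i => eLpNorm (mollify (φ i) g - g) (ENNReal.ofReal p) volume) l (𝓝 0) := by
  have hP1 : 1 ≤ ENNReal.ofReal p := by simpa using hp
  rw [ENNReal.tendsto_nhds_zero]
  intro ε hε
  -- Approximate $g$ by a compactly supported continuous $h$; the contraction property controls the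
  -- mollification of $g-h$.
  obtain ⟨h, hc, hle, hh, hhp⟩ := hg.exists_hasCompactSupport_eLpNorm_sub_le
    ENNReal.ofReal_ne_top (ε := ε / 3) (ENNReal.div_pos hε.ne' (by norm_num)).ne'
  have h1 := (ENNReal.tendsto_nhds_zero.1
    (tendsto_eLpNorm_mollify_sub_of_continuous hφ hh hc hp)) (ε / 3)
    (ENNReal.div_pos hε.ne' (by norm_num))
  filter_upwards [h1] with i hi
  have hgh : MemLp (g - h) (ENNReal.ofReal p) volume := hg.sub hhp
  have hghl : LocallyIntegrable (g - h) volume := hgh.locallyIntegrable hP1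
  have hhl : LocallyIntegrable h volume := hhp.locallyIntegrable hP1
  have hdec : mollify (φ i) g - g
      = mollify (φ i) (g - h) + ((mollify (φ i) h - h) - (g - h)) := by
    have : mollify (φ i) g = mollify (φ i) (g - h) + mollify (φ i) h := by
      rw [← mollify_add _ hghl hhl, sub_add_cancel]
    rw [this]
    abel
  have m1 : AEStronglyMeasurable (mollify (φ i) (g - h)) volume :=
    (continuous_mollify _ hghl).aestronglyMeasurable
  have m2 : AEStronglyMeasurable (mollify (φ i) h - h) volume :=
    ((continuous_mollify _ hhl).sub hh).aestronglyMeasurable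
  rw [hdec]
  calc _ ≤ eLpNorm (mollify (φ i) (g - h)) (ENNReal.ofReal p) volume
        + eLpNorm ((mollify (φ i) h - h) - (g - h)) (ENNReal.ofReal p) volume :=
        eLpNorm_add_le m1 (m2.sub hgh.1) hP1
    _ ≤ ε / 3 + (ε / 3 + ε / 3) := by
        gcongr
        · exact (eLpNorm_mollify_le _ hgh.1 hp).trans hle
        · exact (eLpNorm_sub_le m2 hgh.1 hP1).trans (add_le_add hi hle)
    _ = ε := by rw [← add_assoc, ENNReal.add_thirds]

end Mollification

/-! ### Weak gradients under mollification, and limits of pairings. -/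

section WeakGradient

variable {n : ℕ}

lemma IsTestFunction.contDiff_one {φ : EuclideanSpace ℝ (Fin n) → ℝ} (hφ : IsTestFunction φ) :
    ContDiff ℝ 1 φ := hφ.1.of_le (by norm_cast)

lemma IsTestFunction.hasCompactSupport_gradient {φ : EuclideanSpace ℝ (Fin n) → ℝ}
    (hφ : IsTestFunction φ) : HasCompactSupport (gradient φ) :=
  HasCompactSupport.intro hφ.2 fun _ hx => gradient_eq_zero_of_notMem_tsupport hx

lemma IsTestFunction.continuous_gradient {φ : EuclideanSpace ℝ (Fin n) → ℝ}
    (hφ : IsTestFunction φ) : Continuous (gradient φ) :=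
  _root_.continuous_gradient hφ.contDiff_one

/-- The gradient of a mollification is the mollification of the weak gradient. -/
lemma IsWeakGradient.hasGradientAt_mollify {w : EuclideanSpace ℝ (Fin n) → ℝ}
    {Gw : EuclideanSpace ℝ (Fin n) → EuclideanSpace ℝ (Fin n)} (hw : IsWeakGradient w Gw)
    (φ : ContDiffBump (0 : EuclideanSpace ℝ (Fin n))) (x : EuclideanSpace ℝ (Fin n)) :
    HasGradientAt (mollify φ w) (mollify φ Gw x) x := by
  set ρ := φ.normed (volume : Measure (EuclideanSpace ℝ (Fin n)))
  have hρ : ContDiff ℝ ∞ ρ := φ.contDiff_normed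
  have hρ1 : ContDiff ℝ 1 ρ := φ.contDiff_normed
  have hρc : HasCompactSupport ρ := φ.hasCompactSupport_normed
  have h1 := hρc.hasFDerivAt_convolution_left (ContinuousLinearMap.lsmul ℝ ℝ) hρ1 hw.1 x
  rw [hasGradientAt_iff_hasFDerivAt]
  convert! h1 using 1
  -- The reflected and translated kernel is the test function that turns the weak gradient identity
  -- into the formula at $x$.
  set θ : EuclideanSpace ℝ (Fin n) → ℝ := fun t => ρ (x - t)
  have hθc : HasCompactSupport θ := hρc.comp_homeomorph (Homeomorph.subLeft x)
  have hθ : IsTestFunction θ := ⟨hρ.comp (contDiff_const.sub contDiff_id), hθc⟩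
  have hgθ : ∀ t, gradient θ t = -gradient ρ (x - t) := by
    intro t
    refine HasGradientAt.gradient ?_
    have h2 : HasFDerivAt (fun t : EuclideanSpace ℝ (Fin n) => x - t)
        (-ContinuousLinearMap.id ℝ (EuclideanSpace ℝ (Fin n))) t := by
      exact (hasFDerivAt_id t).const_sub x
    have h3 := (hasGradientAt_of_contDiff hρ1 (x - t)).hasFDerivAt.comp t h2
    rw [hasGradientAt_iff_hasFDerivAt]
    convert! h3 using 1
    ext η
    simp
  have hint : Integrable fun t => w t • gradient θ t :=
    hw.1.integrable_smul_right_of_hasCompactSupport hθ.continuous_gradient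
      hθ.hasCompactSupport_gradient
  have hex : Integrable fun t => (ContinuousLinearMap.precompL (EuclideanSpace ℝ (Fin n))
      (ContinuousLinearMap.lsmul ℝ ℝ) (fderiv ℝ ρ (x - t))) (w t) := by
    have := (HasCompactSupport.convolutionExists_left
      (ContinuousLinearMap.precompL (EuclideanSpace ℝ (Fin n)) (ContinuousLinearMap.lsmul ℝ ℝ))
      (hρc.fderiv (𝕜 := ℝ)) (hρ1.continuous_fderiv (by norm_num)) hw.1 x).integrable_swap
    exact this
  have hm : mollify φ Gw x = -∫ t, w t • gradient θ t := by
    rw [hw.2.2 θ hθ, neg_neg]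
    exact convolution_eq_swap _
  rw [hm, convolution_eq_swap]
  ext η
  rw [ContinuousLinearMap.integral_apply hex, InnerProductSpace.toDual_apply_apply,
    inner_neg_left, real_inner_comm, ← integral_inner hint, ← integral_neg]
  refine integral_congr_ae (Eventually.of_forall fun t => ?_)
  have hfg : inner ℝ η (gradient ρ (x - t)) = fderiv ℝ ρ (x - t) η := by
    rw [real_inner_comm, gradient, InnerProductSpace.toDual_symm_apply]
  simp only [hgθ, inner_smul_right, inner_neg_right, hfg]
  simp [ContinuousLinearMap.precompL_apply, mul_comm]

/-- A continuously differentiable function has its classical gradient as weak gradient. -/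
lemma isWeakGradient_of_hasGradientAt {v : EuclideanSpace ℝ (Fin n) → ℝ}
    {Gv : EuclideanSpace ℝ (Fin n) → EuclideanSpace ℝ (Fin n)}
    (hv : ∀ x, HasGradientAt v (Gv x) x) (hG : Continuous Gv) : IsWeakGradient v Gv := by
  have hvc : Continuous v :=
    continuous_iff_continuousAt.2 fun x => (hv x).hasFDerivAt.continuousAt
  refine ⟨hvc.locallyIntegrable, hG.locallyIntegrable, fun φ hφ => ?_⟩
  have i1 : Integrable fun x => v x • gradient φ x :=
    (hvc.smul hφ.continuous_gradient).integrable_of_hasCompactSupport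
      hφ.hasCompactSupport_gradient.smul_left
  have i2 : Integrable fun x => φ x • Gv x :=
    (hφ.1.continuous.smul hG).integrable_of_hasCompactSupport hφ.2.smul_right
  have i3 : Integrable fun x => v x * φ x :=
    (hvc.mul hφ.1.continuous).integrable_of_hasCompactSupport hφ.2.mul_left
  refine ext_inner_left ℝ fun η => ?_
  have hfv : ∀ x, fderiv ℝ v x η = inner ℝ η (Gv x) := fun x => by
    rw [(hv x).hasFDerivAt.fderiv, InnerProductSpace.toDual_apply_apply, real_inner_comm]
  have hfφ : ∀ x, fderiv ℝ φ x η = inner ℝ η (gradient φ x) := fun x => by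
    rw [real_inner_comm, gradient, InnerProductSpace.toDual_symm_apply]
  rw [inner_neg_right, ← integral_inner i1, ← integral_inner i2]
  have i1' := i1.const_inner (𝕜 := ℝ) η
  have i2' := i2.const_inner (𝕜 := ℝ) η
  simp only [inner_smul_right] at i1' i2' ⊢
  have := integral_mul_fderiv_eq_neg_fderiv_mul_of_integrable
    (μ := (volume : Measure (EuclideanSpace ℝ (Fin n)))) (f := v) (g := φ) (v := η)
    (by simpa only [hfv, mul_comm] using i2') (by simpa only [hfφ] using i1') i3
    (fun x _ => (hv x).hasFDerivAt.differentiableAt)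
    (fun x _ => hφ.contDiff_one.differentiable (by norm_num) x)
  simpa only [hfv, hfφ, mul_comm] using this

lemma IsWeakGradient.sub {v u : EuclideanSpace ℝ (Fin n) → ℝ}
    {Gv Gu : EuclideanSpace ℝ (Fin n) → EuclideanSpace ℝ (Fin n)} (hv : IsWeakGradient v Gv)
    (hu : IsWeakGradient u Gu) : IsWeakGradient (v - u) (Gv - Gu) := by
  refine ⟨hv.1.sub hu.1, hv.2.1.sub hu.2.1, fun φ hφ => ?_⟩
  have i1 := hv.1.integrable_smul_right_of_hasCompactSupport hφ.continuous_gradient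
    hφ.hasCompactSupport_gradient
  have i2 := hu.1.integrable_smul_right_of_hasCompactSupport hφ.continuous_gradient
    hφ.hasCompactSupport_gradient
  have i3 := hv.2.1.integrable_smul_left_of_hasCompactSupport hφ.1.continuous hφ.2
  have i4 := hu.2.1.integrable_smul_left_of_hasCompactSupport hφ.1.continuous hφ.2
  simp only [Pi.sub_apply, sub_smul, smul_sub]
  rw [integral_sub i1 i2, integral_sub i3 i4, hv.2.2 φ hφ, hu.2.2 φ hφ]
  abel

/-- Passage to the limit in a pairing of `L^q` with an `L^p`-convergent sequence, weighted by
bounded pointwise convergent factors. -/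
lemma tendsto_integral_mul_inner {μ : Measure (EuclideanSpace ℝ (Fin n))} {P Q : ENNReal}
    [Q.HolderTriple P 1] {Y g : EuclideanSpace ℝ (Fin n) → EuclideanSpace ℝ (Fin n)}
    (hY : MemLp Y Q μ) {gk : ℕ → EuclideanSpace ℝ (Fin n) → EuclideanSpace ℝ (Fin n)}
    (hg : MemLp g P μ) (hgk : ∀ k, MemLp (gk k) P μ)
    (hlim : Tendsto (fun k => eLpNorm (gk k - g) P μ) atTop (𝓝 0))
    {c : EuclideanSpace ℝ (Fin n) → ℝ} {ck : ℕ → EuclideanSpace ℝ (Fin n) → ℝ} {C : NNReal}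
    (hck : ∀ k, AEStronglyMeasurable (ck k) μ)
    (hb : ∀ᶠ k in atTop, ∀ᵐ x ∂μ, ‖ck k x‖ ≤ C)
    (hcl : ∀ᵐ x ∂μ, Tendsto (fun k => ck k x) atTop (𝓝 (c x))) :
    Tendsto (fun k => ∫ x, ck k x * inner ℝ (Y x) (gk k x) ∂μ) atTop
      (𝓝 (∫ x, c x * inner ℝ (Y x) (g x) ∂μ)) := by
  have hpair : ∀ h : EuclideanSpace ℝ (Fin n) → EuclideanSpace ℝ (Fin n), MemLp h P μ →
      eLpNorm (fun x => inner ℝ (Y x) (h x)) 1 μ ≤ eLpNorm Y Q μ * eLpNorm h P μ := by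
    intro h hh
    have := eLpNorm_le_eLpNorm_mul_eLpNorm_of_nnnorm (p := Q) (q := P) (r := 1) hY.1 hh.1
      (fun a b => inner ℝ a b) 1
      (Eventually.of_forall fun x => by simpa using nnnorm_inner_le_nnnorm (𝕜 := ℝ) (Y x) (h x))
    simpa using this
  have hint : ∀ h : EuclideanSpace ℝ (Fin n) → EuclideanSpace ℝ (Fin n), MemLp h P μ →
      Integrable (fun x => inner ℝ (Y x) (h x)) μ := fun h hh =>
    memLp_one_iff_integrable.1 ⟨hY.1.inner hh.1,
      (hpair h hh).trans_lt (ENNReal.mul_lt_top hY.2 hh.2)⟩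
  -- Split $g_k=(g_k-g)+g$: Hölder handles the first part, dominated convergence the second.
  have hdiff : Tendsto (fun k => ∫ x, ck k x * inner ℝ (Y x) ((gk k - g) x) ∂μ) atTop (𝓝 0) := by
    rw [tendsto_zero_iff_enorm_tendsto_zero]
    have hz : Tendsto (fun k => (C : ENNReal) * (eLpNorm Y Q μ * eLpNorm (gk k - g) P μ)) atTop
        (𝓝 0) := by
      have h1 := ENNReal.Tendsto.const_mul hlim (a := eLpNorm Y Q μ) (Or.inr hY.2.ne)
      rw [mul_zero] at h1
      have h2 := ENNReal.Tendsto.const_mul h1 (a := (C : ENNReal)) (Or.inr ENNReal.coe_ne_top)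
      rwa [mul_zero] at h2
    refine tendsto_of_tendsto_of_tendsto_of_le_of_le' tendsto_const_nhds hz
      (Eventually.of_forall fun _ => zero_le) ?_
    filter_upwards [hb] with k hk
    refine (enorm_integral_le_lintegral_enorm _).trans ?_
    rw [← eLpNorm_one_eq_lintegral_enorm]
    refine (eLpNorm_le_nnreal_smul_eLpNorm_of_ae_le_mul
      (g := fun x => inner ℝ (Y x) ((gk k - g) x)) (c := C) ?_ 1).trans ?_
    · filter_upwards [hk] with x hx
      rw [nnnorm_mul]
      exact mul_le_mul_of_nonneg_right (by exact_mod_cast hx) zero_le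
    · rw [ENNReal.smul_def, smul_eq_mul]
      gcongr
      exact hpair _ ((hgk k).sub hg)
  have hmain : Tendsto (fun k => ∫ x, ck k x * inner ℝ (Y x) (g x) ∂μ) atTop
      (𝓝 (∫ x, c x * inner ℝ (Y x) (g x) ∂μ)) := by
    refine tendsto_integral_filter_of_dominated_convergence
      (fun x => C * ‖(inner ℝ (Y x) (g x) : ℝ)‖) (Eventually.of_forall fun k =>
        (hck k).mul (hint g hg).1) ?_ ((hint g hg).norm.const_mul _) ?_
    · filter_upwards [hb] with k hk
      filter_upwards [hk] with x hx
      rw [norm_mul]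
      exact mul_le_mul_of_nonneg_right hx (norm_nonneg _)
    · filter_upwards [hcl] with x hx
      exact hx.mul_const _
  have hsum := hdiff.add hmain
  rw [zero_add] at hsum
  refine hsum.congr' ?_
  filter_upwards [hb] with k hk
  have i1 : Integrable (fun x => ck k x * inner ℝ (Y x) ((gk k - g) x)) μ :=
    (hint _ ((hgk k).sub hg)).bdd_mul (hck k) hk
  have i2 : Integrable (fun x => ck k x * inner ℝ (Y x) (g x)) μ :=
    (hint _ hg).bdd_mul (hck k) hk
  rw [← integral_add i1 i2]
  congr 1
  funext x
  rw [Pi.sub_apply, inner_sub_right]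
  ring

end WeakGradient

/-! ### The weak comparison principle. -/

section Comparison

variable {n : ℕ}

lemma integrable_inner_of_hasCompactSupport
    {A B : EuclideanSpace ℝ (Fin n) → EuclideanSpace ℝ (Fin n)} (hA : LocallyIntegrable A)
    (hB : Continuous B) (hc : HasCompactSupport B) : Integrable fun x => inner ℝ (A x) (B x) := by
  have h1 : Integrable fun x => ‖B x‖ • A x :=
    hA.integrable_smul_left_of_hasCompactSupport hB.norm hc.norm
  refine h1.mono (hA.aestronglyMeasurable.inner hB.aestronglyMeasurable)
    (Eventually.of_forall fun x => ?_)
  rw [norm_smul, norm_norm, mul_comm]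
  exact norm_inner_le_norm _ _

lemma IsAnisotropy.memLp_anisotropicField {H : EuclideanSpace ℝ (Fin n) → ℝ}
    (hH : IsAnisotropy H) {p : ℝ} (hp : 1 < p)
    {G : EuclideanSpace ℝ (Fin n) → EuclideanSpace ℝ (Fin n)}
    {μ : Measure (EuclideanSpace ℝ (Fin n))} (hG : MemLp G (ENNReal.ofReal p) μ) :
    MemLp (fun x => anisotropicField p H (G x)) (ENNReal.ofReal (p / (p - 1))) μ := by
  obtain ⟨C, hC, hb⟩ := hH.exists_norm_anisotropicField_le hp
  have h1 := hG.norm_rpow_div (ENNReal.ofReal (p - 1))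
  rw [← ENNReal.ofReal_div_of_pos (by linarith), ENNReal.toReal_ofReal (by linarith)] at h1
  refine h1.of_le_mul ((hH.continuous_anisotropicField hp).comp_aestronglyMeasurable hG.1)
    (c := C) (Eventually.of_forall fun x => ?_)
  rw [Real.norm_of_nonneg (by positivity)]
  exact hb _

lemma holderTriple_ofReal {p : ℝ} (hp : 1 < p) :
    (ENNReal.ofReal (p / (p - 1))).HolderTriple (ENNReal.ofReal p) 1 := by
  have h : (p / (p - 1)).HolderConjugate p :=
    (Real.HolderConjugate.conjExponent hp).symm
  exact h.ennrealOfReal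

lemma Continuous.memLp_restrict_isCompact {F : Type*} [NormedAddCommGroup F]
    {g : EuclideanSpace ℝ (Fin n) → F} (hg : Continuous g) {K : Set (EuclideanSpace ℝ (Fin n))}
    (hK : IsCompact K) (P : ENNReal) : MemLp g P (volume.restrict K) := by
  obtain ⟨C, hC⟩ := hK.exists_bound_of_continuousOn hg.continuousOn
  have : IsFiniteMeasure ((volume : Measure (EuclideanSpace ℝ (Fin n))).restrict K) :=
    isFiniteMeasure_restrict.2 hK.measure_lt_top.ne
  refine MemLp.of_bound (hg.continuousOn.aestronglyMeasurable_of_isCompact hK hK.measurableSet) C ?_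
  exact (ae_restrict_iff' hK.measurableSet).2 (Eventually.of_forall hC)

lemma locallyIntegrable_anisotropicField {H : EuclideanSpace ℝ (Fin n) → ℝ}
    (hH : IsAnisotropy H) {p : ℝ} (hp : 1 < p)
    {G : EuclideanSpace ℝ (Fin n) → EuclideanSpace ℝ (Fin n)} (hG : MemLpLoc p G) :
    LocallyIntegrable fun x => anisotropicField p H (G x) := by
  rw [locallyIntegrable_iff]
  intro K hK
  have : IsFiniteMeasure ((volume : Measure (EuclideanSpace ℝ (Fin n))).restrict K) :=
    isFiniteMeasure_restrict.2 hK.measure_lt_top.ne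
  refine (hH.memLp_anisotropicField hp (hG K hK)).integrable ?_
  rw [ENNReal.one_le_ofReal, le_div_iff₀ (by linarith)]
  linarith

/-- A sequence of bump functions shrinking to the origin. -/
noncomputable def shrinkingBump (n k : ℕ) : ContDiffBump (0 : EuclideanSpace ℝ (Fin n)) where
  rIn := 1 / ((k : ℝ) + 1) / 2
  rOut := 1 / ((k : ℝ) + 1)
  rIn_pos := by positivity
  rIn_lt_rOut := half_lt_self (by positivity)

lemma tendsto_shrinkingBump_rOut (n : ℕ) :
    Tendsto (fun k => (shrinkingBump n k).rOut) atTop (𝓝 0) :=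
  tendsto_one_div_add_atTop_nhds_zero_nat

lemma shrinkingBump_rOut_le (n k : ℕ) : (shrinkingBump n k).rOut ≤ 1 := by
  have : (0 : ℝ) ≤ k := Nat.cast_nonneg k
  exact (div_le_one (by positivity)).2 (by linarith)

/-- Mollifications of a continuous function converge uniformly on compact sets. -/
lemma eventually_forall_dist_mollify_le {w : EuclideanSpace ℝ (Fin n) → ℝ} (hw : Continuous w)
    {K : Set (EuclideanSpace ℝ (Fin n))} (hK : IsCompact K) {ε : ℝ} (hε : 0 < ε) :
    ∀ᶠ k in atTop, ∀ x ∈ K, dist (mollify (shrinkingBump n k) w x) (w x) ≤ ε := by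
  have hK' : IsCompact (Metric.cthickening 1 K) := hK.cthickening
  obtain ⟨δ, hδ, hu⟩ := Metric.uniformContinuousOn_iff.1
    (hK'.uniformContinuousOn_of_continuous hw.continuousOn) ε hε
  filter_upwards [(tendsto_shrinkingBump_rOut n).eventually (gt_mem_nhds hδ)] with k hk x hx
  refine (shrinkingBump n k).dist_normed_convolution_le hw.aestronglyMeasurable fun y hy => ?_
  have hy : dist y x < _ := hy
  refine (hu y (Metric.mem_cthickening_of_dist_le y x 1 _ hx
    (hy.le.trans (shrinkingBump_rOut_le n k))) x (Metric.self_subset_cthickening _ hx) ?_).le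
  exact hy.trans hk

lemma expNegInvGlue_hasDerivAt (s : ℝ) :
    HasDerivAt expNegInvGlue (deriv expNegInvGlue s) s :=
  ((expNegInvGlue.contDiff (n := 1)).differentiable (by norm_num) s).hasDerivAt

lemma continuous_deriv_expNegInvGlue : Continuous (deriv expNegInvGlue) :=
  (expNegInvGlue.contDiff (n := 1)).continuous_deriv (by norm_num)

lemma gradient_mul_comp {χ w : EuclideanSpace ℝ (Fin n) → ℝ} {ψ : ℝ → ℝ}
    {gχ gw x : EuclideanSpace ℝ (Fin n)} {d : ℝ} (hχ : HasGradientAt χ gχ x)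
    (hw : HasGradientAt w gw x) (hψ : HasDerivAt ψ d (w x)) :
    gradient (fun y => χ y * ψ (w y)) x = (χ x * d) • gw + ψ (w x) • gχ := by
  refine HasGradientAt.gradient ?_
  have h := hχ.hasFDerivAt.mul (hψ.comp_hasFDerivAt x hw.hasFDerivAt)
  rw [hasGradientAt_iff_hasFDerivAt]
  convert! h using 1
  ext η
  simp
  ring

/-- Weak comparison principle, localised by the cut-off function `χ`. -/
theorem weak_comparison {H : EuclideanSpace ℝ (Fin n) → ℝ} (hH : IsAnisotropy H) {p : ℝ}
    (hp : 1 < p) {u : EuclideanSpace ℝ (Fin n) → ℝ}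
    {G : EuclideanSpace ℝ (Fin n) → EuclideanSpace ℝ (Fin n)} (hu : Continuous u)
    (hG : HasSobolevGradient p u G) {v : EuclideanSpace ℝ (Fin n) → ℝ}
    {Gv : EuclideanSpace ℝ (Fin n) → EuclideanSpace ℝ (Fin n)}
    (hv : ∀ x, HasGradientAt v (Gv x) x) (hGv : Continuous Gv)
    {b c : EuclideanSpace ℝ (Fin n) → ℝ} (hb : Continuous b) (hc : Continuous c)
    (hsub : ∀ φ, IsTestFunction φ →
      ∫ x, inner ℝ (anisotropicField p H (Gv x)) (gradient φ x) = ∫ x, b x * φ x)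
    (hsup : ∀ φ, IsTestFunction φ → (∀ x, 0 ≤ φ x) →
      ∫ x, c x * φ x ≤ ∫ x, inner ℝ (anisotropicField p H (G x)) (gradient φ x))
    {χ : EuclideanSpace ℝ (Fin n) → ℝ} (hχ : IsTestFunction χ) (hχ0 : ∀ x, 0 ≤ χ x)
    {δ : ℝ} (hδ : 0 < δ) (hbd : ∀ x, gradient χ x ≠ 0 → v x - u x ≤ -δ)
    (hlt : ∀ x, χ x ≠ 0 → u x < v x → b x < c x) : ∀ x, χ x ≠ 0 → v x ≤ u x := by
  have hvc : Continuous v :=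
    continuous_iff_continuousAt.2 fun x => (hv x).hasFDerivAt.continuousAt
  set w := v - u
  have hw : Continuous w := hvc.sub hu
  set Gw := Gv - G
  have hweak : IsWeakGradient w Gw := (isWeakGradient_of_hasGradientAt hv hGv).sub hG.1
  set K := tsupport χ
  have hK : IsCompact K := hχ.2
  set B := Metric.cthickening 1 K
  have hB : IsCompact B := hK.cthickening
  have hKB : K ⊆ B := Metric.self_subset_cthickening _
  set μ := (volume : Measure (EuclideanSpace ℝ (Fin n))).restrict K
  have hGvloc : MemLpLoc p Gv := fun K' hK' => hGv.memLp_restrict_isCompact hK' _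
  -- Cutting off to the 1-thickening of $K$ makes the gradient globally $L^p$ without changing its
  -- mollifications on $K$, since all radii are at most 1.
  have hGwB : MemLp (B.indicator Gw) (ENNReal.ofReal p) volume := by
    rw [memLp_indicator_iff_restrict hB.measurableSet]
    exact (hGvloc B hB).sub (hG.2.2 B hB)
  set Y : EuclideanSpace ℝ (Fin n) → EuclideanSpace ℝ (Fin n) :=
    fun x => anisotropicField p H (G x) - anisotropicField p H (Gv x) with hYdef
  have hY : MemLp Y (ENNReal.ofReal (p / (p - 1))) μ :=
    (hH.memLp_anisotropicField hp (hG.2.2 K hK)).sub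
      (hH.memLp_anisotropicField hp (hGvloc K hK))
  set gk : ℕ → EuclideanSpace ℝ (Fin n) → EuclideanSpace ℝ (Fin n) :=
    fun k => mollify (shrinkingBump n k) (B.indicator Gw)
  set wk : ℕ → EuclideanSpace ℝ (Fin n) → ℝ := fun k => mollify (shrinkingBump n k) w
  have hp1 : 1 ≤ ENNReal.ofReal p := by simpa using hp.le
  have hgkc : ∀ k, Continuous (gk k) := fun k =>
    continuous_mollify _ (hGwB.locallyIntegrable hp1)
  have hwks : ∀ k, ContDiff ℝ ∞ (wk k) := fun k => contDiff_mollify _ hw.locallyIntegrable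
  have hgk : ∀ k, ∀ x ∈ K, HasGradientAt (wk k) (gk k x) x := by
    intro k x hx
    have h1 := hweak.hasGradientAt_mollify (shrinkingBump n k) x
    have h2 : mollify (shrinkingBump n k) Gw x = gk k x := by
      refine mollify_congr _ fun y hy => (indicator_of_mem ?_ _).symm
      exact Metric.mem_cthickening_of_dist_le y x 1 _ hx
        ((Metric.mem_ball.1 hy).le.trans (shrinkingBump_rOut_le n k))
    rwa [h2] at h1
  have hlim : Tendsto (fun k => eLpNorm (gk k - B.indicator Gw) (ENNReal.ofReal p) μ) atTop
      (𝓝 0) := by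
    refine tendsto_of_tendsto_of_tendsto_of_le_of_le tendsto_const_nhds
      (tendsto_eLpNorm_mollify_sub (tendsto_shrinkingBump_rOut n) hp.le hGwB)
      (fun _ => zero_le) fun k => ?_
    exact eLpNorm_mono_measure _ Measure.restrict_le_self
  have hclose : ∀ ε : ℝ, 0 < ε → ∀ᶠ k in atTop, ∀ x ∈ K, dist (wk k x) (w x) ≤ ε :=
    fun ε hε => eventually_forall_dist_mollify_le hw hK hε
  have hptw : ∀ x ∈ K, Tendsto (fun k => wk k x) atTop (𝓝 (w x)) := fun x _ =>
    ContDiffBump.convolution_tendsto_right_of_continuous (tendsto_shrinkingBump_rOut n) hw x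
  -- A smooth nondecreasing substitute for the positive part, positive exactly on $(0,\infty)$.
  -- Composed with mollifications of $w$ and multiplied by $\chi$, it gives admissible smooth test
  -- functions.
  set ψ := expNegInvGlue
  have hψs : ContDiff ℝ ∞ ψ := expNegInvGlue.contDiff
  have hψc : Continuous ψ := hψs.continuous
  -- the test functions
  set Φ : ℕ → EuclideanSpace ℝ (Fin n) → ℝ := fun k x => χ x * ψ (wk k x)
  have hΦ : ∀ k, IsTestFunction (Φ k) := fun k =>
    ⟨hχ.1.mul (hψs.comp (hwks k)), hχ.2.mul_right⟩
  have hΦ0 : ∀ k x, 0 ≤ Φ k x := fun k x => mul_nonneg (hχ0 x) (expNegInvGlue.nonneg _)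
  have hΦg : ∀ᶠ k in atTop, ∀ x, gradient (Φ k) x = (χ x * deriv ψ (wk k x)) • gk k x := by
    filter_upwards [hclose δ hδ] with k hk x
    by_cases hx : x ∈ K
    · have hg := gradient_mul_comp (hasGradientAt_of_contDiff hχ.contDiff_one x)
        (hgk k x hx) (expNegInvGlue_hasDerivAt (wk k x))
      -- Where $\nabla\chi\ne0$ one has $w\le-\delta$, and $w_k$ is within $\delta$ of $w$, so
      -- $w_k\le0$ and the cut-off term disappears.
      have hz : ψ (wk k x) • gradient χ x = 0 := by
        by_cases hgz : gradient χ x = 0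
        · rw [hgz, smul_zero]
        · have h1 := hbd x hgz
          have h2 := (abs_le.1 (hk x hx)).2
          have h3 : w x = v x - u x := rfl
          have h4 : ψ (wk k x) = 0 := expNegInvGlue.zero_of_nonpos (by linarith)
          rw [h4, zero_smul]
      rw [hz, add_zero] at hg
      exact hg
    · have h1 : x ∉ tsupport (Φ k) := fun h => hx (tsupport_mul_subset_left h)
      rw [gradient_eq_zero_of_notMem_tsupport h1, image_eq_zero_of_notMem_tsupport hx, zero_mul,
        zero_smul]
  have hIneq : ∀ᶠ k in atTop, ∫ x, (c x - b x) * Φ k x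
      ≤ ∫ x, (χ x * deriv ψ (wk k x)) * inner ℝ (Y x) (gk k x) ∂μ := by
    filter_upwards [hΦg] with k hk
    have h1 := hsup (Φ k) (hΦ k) (hΦ0 k)
    have h2 := hsub (Φ k) (hΦ k)
    have i1 : Integrable fun x => c x * Φ k x :=
      (hc.mul (hΦ k).1.continuous).integrable_of_hasCompactSupport (hΦ k).2.mul_left
    have i2 : Integrable fun x => b x * Φ k x :=
      (hb.mul (hΦ k).1.continuous).integrable_of_hasCompactSupport (hΦ k).2.mul_left
    have i3 := integrable_inner_of_hasCompactSupport
      (locallyIntegrable_anisotropicField hH hp hG.2.2) (hΦ k).continuous_gradient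
      (hΦ k).hasCompactSupport_gradient
    have i4 := integrable_inner_of_hasCompactSupport
      (locallyIntegrable_anisotropicField hH hp hGvloc) (hΦ k).continuous_gradient
      (hΦ k).hasCompactSupport_gradient
    have h3 : ∫ x, (c x - b x) * Φ k x = (∫ x, c x * Φ k x) - ∫ x, b x * Φ k x := by
      rw [← integral_sub i1 i2]
      simp only [sub_mul]
    have h4 : ∫ x, (χ x * deriv ψ (wk k x)) * inner ℝ (Y x) (gk k x) ∂μ
        = (∫ x, inner ℝ (anisotropicField p H (G x)) (gradient (Φ k) x))
          - ∫ x, inner ℝ (anisotropicField p H (Gv x)) (gradient (Φ k) x) := by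
      rw [← integral_sub i3 i4]
      rw [setIntegral_eq_integral_of_forall_compl_eq_zero fun x hx => by
        rw [image_eq_zero_of_notMem_tsupport hx, zero_mul, zero_mul]]
      congr 1
      funext x
      rw [hk x, inner_smul_right, inner_smul_right, hYdef, inner_sub_left]
      ring
    rw [h3, h4]
    linarith
  -- limit of the right-hand sides
  obtain ⟨M, hM⟩ := hK.exists_bound_of_continuousOn hw.continuousOn
  obtain ⟨D, hD⟩ := (isCompact_Icc (a := -(M + 1)) (b := M + 1)).exists_bound_of_continuousOn
    continuous_deriv_expNegInvGlue.continuousOn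
  obtain ⟨X, hX⟩ := hK.exists_bound_of_continuousOn hχ.1.continuous.continuousOn
  have := holderTriple_ofReal hp
  have hgkp : ∀ k, MemLp (gk k) (ENNReal.ofReal p) μ := fun k =>
    (hgkc k).memLp_restrict_isCompact hK _
  have hR := tendsto_integral_mul_inner (μ := μ) hY
    (hGwB.mono_measure Measure.restrict_le_self) hgkp hlim
    (c := fun x => χ x * deriv ψ (w x)) (ck := fun k x => χ x * deriv ψ (wk k x))
    (C := Real.toNNReal (X * D))
    (fun k => (hχ.1.continuous.mul
      (continuous_deriv_expNegInvGlue.comp (hwks k).continuous)).aestronglyMeasurable)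
    (by
      filter_upwards [hclose 1 one_pos] with k hk
      refine (ae_restrict_iff' hK.measurableSet).2 (Eventually.of_forall fun x hx => ?_)
      refine le_trans ?_ (Real.le_coe_toNNReal _)
      rw [norm_mul]
      have h1 := abs_le.1 (hk x hx)
      have h2 := abs_le.1 (hM x hx)
      refine mul_le_mul (hX x hx) (hD _ ⟨by linarith [h1.1, h2.1], by linarith [h1.2, h2.2]⟩)
        (norm_nonneg _) ((norm_nonneg _).trans (hX x hx)))
    ((ae_restrict_iff' hK.measurableSet).2 (Eventually.of_forall fun x hx =>
      ((continuous_deriv_expNegInvGlue.tendsto _).comp (hptw x hx)).const_mul _))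
  -- The limit has a sign by monotonicity of $a$ and of $\psi$.
  have hRle : ∫ x, (χ x * deriv ψ (w x)) * inner ℝ (Y x) (B.indicator Gw x) ∂μ ≤ 0 := by
    refine integral_nonpos_of_ae
      ((ae_restrict_iff' hK.measurableSet).2 (Eventually.of_forall fun x hx => ?_))
    have h1 := hH.inner_anisotropicField_sub_nonneg hp (Gv x) (G x)
    have h2 : inner ℝ (Y x) (B.indicator Gw x)
        = -inner ℝ (anisotropicField p H (Gv x) - anisotropicField p H (G x)) (Gv x - G x) := by
      rw [indicator_of_mem (hKB hx), ← inner_neg_left, neg_sub]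
      rfl
    change χ x * deriv ψ (w x) * inner ℝ (Y x) (B.indicator Gw x) ≤ 0
    rw [h2]
    have h3 : 0 ≤ χ x * deriv ψ (w x) :=
      mul_nonneg (hχ0 x) expNegInvGlue.monotone.deriv_nonneg
    exact mul_nonpos_of_nonneg_of_nonpos h3 (by linarith)
  -- limit of the left-hand sides
  have hLc : Continuous fun x => (c x - b x) * (χ x * ψ (w x)) :=
    (hc.sub hb).mul (hχ.1.continuous.mul (hψc.comp hw))
  have hL : Tendsto (fun k => ∫ x, (c x - b x) * Φ k x) atTop
      (𝓝 (∫ x, (c x - b x) * (χ x * ψ (w x)))) := by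
    have hbc : Continuous fun x => |c x - b x| * (χ x * ψ (w x + 1)) :=
      (hc.sub hb).abs.mul (hχ.1.continuous.mul (hψc.comp (hw.add continuous_const)))
    refine tendsto_integral_filter_of_dominated_convergence
      (fun x => |c x - b x| * (χ x * ψ (w x + 1))) (Eventually.of_forall fun k =>
        ((hc.sub hb).mul (hΦ k).1.continuous).aestronglyMeasurable) ?_
      (hbc.integrable_of_hasCompactSupport hχ.2.mul_right.mul_left)
      (Eventually.of_forall fun x => ?_)
    · filter_upwards [hclose 1 one_pos] with k hk
      refine Eventually.of_forall fun x => ?_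
      rw [norm_mul, Real.norm_of_nonneg (hΦ0 k x), Real.norm_eq_abs]
      by_cases hx : x ∈ K
      · have h1 := (abs_le.1 (hk x hx)).2
        exact mul_le_mul_of_nonneg_left (mul_le_mul_of_nonneg_left
          (expNegInvGlue.monotone (by linarith)) (hχ0 x)) (abs_nonneg _)
      · simp only [Φ, image_eq_zero_of_notMem_tsupport hx, zero_mul, mul_zero, le_refl]
    · by_cases hx : x ∈ K
      · exact (((hψc.tendsto _).comp (hptw x hx)).const_mul _).const_mul _
      · simp only [Φ, image_eq_zero_of_notMem_tsupport hx, zero_mul, mul_zero]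
        exact tendsto_const_nhds
  -- The integrand is continuous and nonnegative, and it is strictly positive wherever $\chi\ne0$
  -- and $v>u$; a nonpositive integral excludes such points.
  have hfin : ∫ x, (c x - b x) * (χ x * ψ (w x)) ≤ 0 :=
    (le_of_tendsto_of_tendsto hL hR hIneq).trans hRle
  have hnn : ∀ x, 0 ≤ (c x - b x) * (χ x * ψ (w x)) := by
    intro x
    by_cases hx : χ x = 0
    · rw [hx, zero_mul, mul_zero]
    by_cases hwx : u x < v x
    · exact mul_nonneg (sub_nonneg.2 (hlt x hx hwx).le)
        (mul_nonneg (hχ0 x) (expNegInvGlue.nonneg _))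
    · have : ψ (w x) = 0 := expNegInvGlue.zero_of_nonpos (sub_nonpos.2 (not_lt.1 hwx))
      rw [this, mul_zero, mul_zero]
  intro x hx
  by_contra! hwx
  have hpos := hLc.integral_pos_of_hasCompactSupport_nonneg_nonzero (μ := volume)
    hχ.2.mul_right.mul_left hnn (x := x) (by
      have h1 : 0 < ψ (w x) := expNegInvGlue.pos_of_pos (sub_pos.2 hwx)
      exact mul_ne_zero (sub_pos.2 (hlt x hx hwx)).ne' (mul_ne_zero hx h1.ne'))
  linarith

end Comparison

/-! ### Explicit radial solutions. -/

section Barrier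

/-- The average `∫₀¹ σⁿ⁻¹ g(σr) dσ`. -/
noncomputable def radialAverage (n : ℕ) (g : ℝ → ℝ) (r : ℝ) : ℝ :=
  ∫ σ in (0 : ℝ)..1, σ ^ (n - 1) * g (σ * r)

/-- The slope of the radial solution with right-hand side `g`. -/
noncomputable def barrierSlope (n : ℕ) (p : ℝ) (g : ℝ → ℝ) (r : ℝ) : ℝ :=
  (radialAverage n g r * r) ^ (1 / (p - 1))

/-- The profile of the radial solution with right-hand side `g`. -/
noncomputable def barrier (n : ℕ) (p : ℝ) (g : ℝ → ℝ) (r : ℝ) : ℝ :=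
  -∫ ρ in (0 : ℝ)..r, barrierSlope n p g ρ

variable {n : ℕ} {p : ℝ} {g : ℝ → ℝ}

lemma continuous_radialAverage (hg : Continuous g) : Continuous (radialAverage n g) :=
  intervalIntegral.continuous_parametric_intervalIntegral_of_continuous (by fun_prop)
    continuous_const

lemma radialAverage_nonneg (hg0 : ∀ r, 0 ≤ g r) (r : ℝ) : 0 ≤ radialAverage n g r :=
  intervalIntegral.integral_nonneg zero_le_one fun _ hσ =>
    mul_nonneg (pow_nonneg hσ.1 _) (hg0 _)

lemma continuous_barrierSlope (hp : 1 < p) (hg : Continuous g) :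
    Continuous (barrierSlope n p g) :=
  ((continuous_radialAverage hg).mul continuous_id).rpow_const fun _ =>
    Or.inr (one_div_nonneg.2 (by linarith))

lemma barrierSlope_nonneg (hg0 : ∀ r, 0 ≤ g r) {r : ℝ} (hr : 0 ≤ r) :
    0 ≤ barrierSlope n p g r :=
  Real.rpow_nonneg (mul_nonneg (radialAverage_nonneg hg0 r) hr) _

lemma barrierSlope_zero (hp : 1 < p) : barrierSlope n p g 0 = 0 := by
  rw [barrierSlope, mul_zero, Real.zero_rpow (one_div_ne_zero (by linarith))]

lemma hasDerivAt_barrier (hp : 1 < p) (hg : Continuous g) (r : ℝ) :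
    HasDerivAt (barrier n p g) (-barrierSlope n p g r) r :=
  ((continuous_barrierSlope hp hg).integral_hasStrictDerivAt 0 r).hasDerivAt.neg

lemma barrier_sub (hp : 1 < p) (hg : Continuous g) (r R : ℝ) :
    barrier n p g r - barrier n p g R = ∫ ρ in r..R, barrierSlope n p g ρ := by
  have h := intervalIntegral.integral_interval_sub_left (μ := volume)
    ((continuous_barrierSlope (n := n) hp hg).intervalIntegrable 0 R)
    ((continuous_barrierSlope (n := n) hp hg).intervalIntegrable 0 r)
  rw [← h, barrier, barrier]
  ring

lemma barrier_antitoneOn (hp : 1 < p) (hg : Continuous g) (hg0 : ∀ r, 0 ≤ g r) :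
    AntitoneOn (barrier n p g) (Ici 0) := by
  intro r hr R _ hrR
  rw [← sub_nonneg, barrier_sub hp hg]
  exact intervalIntegral.integral_nonneg hrR fun ρ hρ =>
    barrierSlope_nonneg hg0 (le_trans hr hρ.1)

variable {H : EuclideanSpace ℝ (Fin n) → ℝ}
  {e : EuclideanSpace ℝ (Fin n) → EuclideanSpace ℝ (Fin n)}

/-- Away from the origin this is the chain rule. At the origin the slope of the profile vanishes, so
the increment is $o(N(x))=o(|x|)$ although $N$ need not be differentiable there. -/
lemma hasGradientAt_barrier (he : IsSupportMap H e) (hH : IsAnisotropy H) (hp : 1 < p)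
    (hg : Continuous g) (x : EuclideanSpace ℝ (Fin n)) :
    HasGradientAt (fun y => barrier n p g (dualGauge e y))
      (barrierSlope n p g (dualGauge e x) • e x) x := by
  rcases eq_or_ne x 0 with rfl | hx
  · rw [IsSupportMap.dualGauge_zero, barrierSlope_zero hp, zero_smul,
      hasGradientAt_iff_isLittleO]
    have h1 := hasDerivAt_iff_isLittleO.1 (hasDerivAt_barrier (n := n) (p := p) hp hg 0)
    have ht : Tendsto (dualGauge e) (𝓝 0) (𝓝 0) := by
      have := (he.continuous_dualGauge hH).tendsto 0
      rwa [IsSupportMap.dualGauge_zero] at this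
    have h2 := h1.comp_tendsto ht
    obtain ⟨C, hC, hlip⟩ := he.exists_lipschitz hH
    refine (h2.congr_left fun y => ?_).trans_isBigO (Asymptotics.IsBigO.of_bound C
      (Eventually.of_forall fun y => ?_))
    · simp [barrierSlope_zero hp, IsSupportMap.dualGauge_zero]
    · have := hlip y 0
      simpa [IsSupportMap.dualGauge_zero] using this
  · have h := (hasDerivAt_barrier (n := n) (p := p) hp hg (dualGauge e x)).comp_hasFDerivAt x
      (he.hasGradientAt_dualGauge hH hx).hasFDerivAt
    rw [hasGradientAt_iff_hasFDerivAt]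
    convert! h using 1
    ext η
    simp

lemma continuous_barrier_gradient (he : IsSupportMap H e) (hH : IsAnisotropy H) (hp : 1 < p)
    (hg : Continuous g) : Continuous fun x => barrierSlope n p g (dualGauge e x) • e x := by
  have hs : Continuous fun x => barrierSlope n p g (dualGauge e x) :=
    (continuous_barrierSlope hp hg).comp (he.continuous_dualGauge hH)
  rw [continuous_iff_continuousAt]
  intro x
  rcases eq_or_ne x 0 with rfl | hx
  · obtain ⟨C, hC, hb⟩ := he.exists_norm_le hH
    rw [ContinuousAt, IsSupportMap.dualGauge_zero, barrierSlope_zero hp, zero_smul]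
    have h1 : Tendsto (fun x => ‖barrierSlope n p g (dualGauge e x)‖ * C) (𝓝 0) (𝓝 0) := by
      have := (hs.norm.mul_const C).tendsto 0
      simpa [IsSupportMap.dualGauge_zero, barrierSlope_zero hp] using this
    refine squeeze_zero_norm (fun x => ?_) h1
    rw [norm_smul]
    exact mul_le_mul_of_nonneg_left (hb x) (norm_nonneg _)
  · exact hs.continuousAt.smul (he.continuousAt hH hx)

/-- The exponent $1/(p-1)$ in the slope is undone by the homogeneity of $a$, and the factor $r=N(x)$
under it cancels the $1/N(x)$ in `IsSupportMap.anisotropicField_eq`. -/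
lemma anisotropicField_barrier (he : IsSupportMap H e) (hH : IsAnisotropy H) (hp : 1 < p)
    (hg0 : ∀ r, 0 ≤ g r) (x : EuclideanSpace ℝ (Fin n)) :
    anisotropicField p H (barrierSlope n p g (dualGauge e x) • e x)
      = -radialAverage n g (dualGauge e x) • x := by
  rcases eq_or_ne x 0 with rfl | hx
  · rw [IsSupportMap.dualGauge_zero, barrierSlope_zero hp, zero_smul,
      hH.anisotropicField_zero hp, smul_zero]
  · have hN := he.dualGauge_pos hH hx
    rw [hH.anisotropicField_smul hp (barrierSlope_nonneg hg0 hN.le),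
      he.anisotropicField_eq hH hp hx, barrierSlope,
      ← Real.rpow_mul (mul_nonneg (radialAverage_nonneg hg0 _) hN.le),
      one_div_mul_cancel (by linarith), Real.rpow_one, smul_smul]
    congr 1
    field_simp

/-- The barrier solves `-div a(∇v) = g(N)` weakly, where `N` is the dual gauge. -/
lemma integral_inner_anisotropicField_barrier (hn : 0 < n) (he : IsSupportMap H e)
    (hH : IsAnisotropy H) (hp : 1 < p) (hg : Continuous g) (hg0 : ∀ r, 0 ≤ g r)
    {φ : EuclideanSpace ℝ (Fin n) → ℝ} (hφ : IsTestFunction φ) :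
    ∫ x, inner ℝ (anisotropicField p H (barrierSlope n p g (dualGauge e x) • e x)) (gradient φ x)
      = ∫ x, g (dualGauge e x) * φ x := by
  have h := integral_radialField_inner_gradient hn (G := fun x => g (dualGauge e x))
    (hg.comp (he.continuous_dualGauge hH)) hφ.contDiff_one hφ.2
  rw [← neg_eq_iff_eq_neg, ← integral_neg] at h
  rw [← h]
  congr 1
  funext x
  rw [anisotropicField_barrier he hH hp hg0, real_inner_smul_left, neg_mul, radialAverage]
  congr 2
  refine intervalIntegral.integral_congr fun σ hσ => ?_
  rw [uIcc_of_le zero_le_one] at hσ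
  simp only [he.dualGauge_smul hσ.1]

end Barrier

/-! ### Comparison of the radial minimum with the barrier. -/

section RadialMinimum

variable {n : ℕ} {H : EuclideanSpace ℝ (Fin n) → ℝ}
  {e : EuclideanSpace ℝ (Fin n) → EuclideanSpace ℝ (Fin n)}

lemma IsSupportMap.isCompact_le (he : IsSupportMap H e) (hH : IsAnisotropy H) (R : ℝ) :
    IsCompact {x | dualGauge e x ≤ R} := by
  obtain ⟨c, hc, hb⟩ := he.exists_le_dualGauge hH
  refine (isCompact_closedBall (0 : EuclideanSpace ℝ (Fin n)) (R / c)).of_isClosed_subset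
    (isClosed_le (he.continuous_dualGauge hH) continuous_const) fun x hx => ?_
  rw [mem_closedBall_zero_iff, le_div_iff₀ hc, mul_comm]
  exact (hb x).trans hx

/-- The minimum of `u` over the balls of the dual gauge. -/
lemma IsSupportMap.exists_radialMinimum (he : IsSupportMap H e) (hH : IsAnisotropy H)
    {u : EuclideanSpace ℝ (Fin n) → ℝ} (hu : Continuous u) (hpos : ∀ x, 0 < u x) :
    ∃ m : ℝ → ℝ, Continuous m ∧ (∀ r, 0 < m r) ∧
      (∀ r, 0 ≤ r → ∀ x, dualGauge e x ≤ r → m r ≤ u x) ∧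
      ∀ r, 0 ≤ r → ∃ x, dualGauge e x ≤ r ∧ u x = m r := by
  set K := {x | dualGauge e x ≤ 1}
  have hK : IsCompact K := he.isCompact_le hH 1
  have hK0 : (0 : EuclideanSpace ℝ (Fin n)) ∈ K := by simp [K, dualGauge_zero]
  -- Rescaling to the fixed compact set $K$ makes the minimum continuous in $r$, and defined for
  -- every real $r$.
  have hatt : ∀ r : ℝ, ∃ y ∈ K, sInf ((fun y => u (r • y)) '' K) = u (r • y) := fun r =>
    hK.exists_sInf_image_eq ⟨0, hK0⟩ (by fun_prop)
  have hle : ∀ r : ℝ, ∀ y ∈ K, sInf ((fun y => u (r • y)) '' K) ≤ u (r • y) := fun r y hy =>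
    csInf_le (hK.image (f := fun y => u (r • y)) (by fun_prop)).bddBelow ⟨y, hy, rfl⟩
  refine ⟨fun r => sInf ((fun y => u (r • y)) '' K), ?_, fun r => ?_, fun r hr x hx => ?_,
    fun r hr => ?_⟩
  · exact hK.continuous_sInf (f := fun (r : ℝ) y => u (r • y)) (by fun_prop)
  · obtain ⟨y, -, h⟩ := hatt r
    simp only [h]
    exact hpos _
  · rcases hr.eq_or_lt with rfl | hr
    · have hx0 : x = 0 := by
        by_contra hne
        exact absurd hx (not_le.2 (he.dualGauge_pos hH hne))
      have := hle 0 0 hK0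
      rwa [smul_zero, ← hx0] at this
    · have hy : r⁻¹ • x ∈ K := by
        change dualGauge e (r⁻¹ • x) ≤ 1
        rw [he.dualGauge_smul (inv_nonneg.2 hr.le), inv_mul_le_iff₀ hr, mul_one]
        exact hx
      have := hle r _ hy
      rwa [smul_inv_smul₀ hr.ne'] at this
  · obtain ⟨y, hy, h⟩ := hatt r
    refine ⟨r • y, ?_, h.symm⟩
    have hy : dualGauge e y ≤ 1 := hy
    rw [he.dualGauge_smul hr]
    nlinarith

lemma IsSupportMap.exists_cutoff (he : IsSupportMap H e) (hH : IsAnisotropy H) {r R : ℝ}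
    (hr : r < R) : ∃ χ : EuclideanSpace ℝ (Fin n) → ℝ, IsTestFunction χ ∧ (∀ x, 0 ≤ χ x) ∧
      (∀ x, dualGauge e x ≤ r → χ x = 1) ∧ (∀ x, χ x ≠ 0 → dualGauge e x < R) ∧
      ∀ x, gradient χ x ≠ 0 → r < dualGauge e x ∧ dualGauge e x ≤ R := by
  have hNc := he.continuous_dualGauge hH
  have hs : IsClosed {x | dualGauge e x ≤ r} := isClosed_le hNc continuous_const
  have ht : IsOpen {x | dualGauge e x < R} := isOpen_lt hNc continuous_const
  obtain ⟨f, hf1, hf0, hf⟩ := exists_contMDiffMap_one_nhds_of_subset_interior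
    (modelWithCornersSelf ℝ (EuclideanSpace ℝ (Fin n))) (n := ⊤) hs
    (t := {x | dualGauge e x < R}) (by
      rw [ht.interior_eq]
      exact fun x hx => lt_of_le_of_lt hx hr)
  have hsupp : ∀ x, f x ≠ 0 → dualGauge e x < R := fun x hx => by
    by_contra h
    exact hx (hf0 x h)
  have hts : tsupport f ⊆ {x | dualGauge e x ≤ R} :=
    closure_minimal (fun x hx => (hsupp x hx).le) (isClosed_le hNc continuous_const)
  refine ⟨f, ⟨f.contMDiff.contDiff, ?_⟩, fun x => (hf x).1, fun x hx => ?_, hsupp,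
    fun x hx => ⟨?_, ?_⟩⟩
  · exact (he.isCompact_le hH R).of_isClosed_subset (isClosed_tsupport _) hts
  · exact hf1.self_of_nhdsSet x hx
  · by_contra! hle
    refine hx ?_
    have h1 : (f : EuclideanSpace ℝ (Fin n) → ℝ) =ᶠ[𝓝 x] fun _ => 1 :=
      hf1.filter_mono (nhds_le_nhdsSet (s := {x | dualGauge e x ≤ r}) hle)
    rw [gradient, h1.fderiv_eq]
    simp
  · by_contra hlt
    exact hx (gradient_eq_zero_of_notMem_tsupport fun h => hlt (hts h))

/-- The radial minimum of a supersolution decreases at least as fast as the radial barrier. -/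
lemma barrier_sub_le_radialMinimum (hn : 0 < n) (he : IsSupportMap H e) (hH : IsAnisotropy H)
    {p : ℝ} (hp : 1 < p) {f : ℝ → ℝ} (hf : ContinuousOn f (Ioi 0)) (hfpos : ∀ t, 0 < t → 0 < f t)
    {u : EuclideanSpace ℝ (Fin n) → ℝ} (hu : IsPositiveSupersolution p H f u) {m : ℝ → ℝ}
    (hm : Continuous m) (hmpos : ∀ r, 0 < m r)
    (hmle : ∀ r, 0 ≤ r → ∀ x, dualGauge e x ≤ r → m r ≤ u x)
    (hmatt : ∀ r, 0 ≤ r → ∃ x, dualGauge e x ≤ r ∧ u x = m r) {r R : ℝ} (hr : 0 ≤ r)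
    (hrR : r ≤ R) :
    barrier n p (fun r => f (m r) / 2) r - barrier n p (fun r => f (m r) / 2) R ≤ m r - m R := by
  obtain ⟨huc, hupos, G, hG, hsup⟩ := hu
  set g : ℝ → ℝ := fun r => f (m r) / 2
  have hg : Continuous g := (hf.comp_continuous hm hmpos).div_const 2
  have hg0 : ∀ r, 0 ≤ g r := fun r => (half_pos (hfpos _ (hmpos r))).le
  have hanti : ∀ a b, 0 ≤ a → a ≤ b → m b ≤ m a := by
    intro a b ha hab
    obtain ⟨x, hx, hxm⟩ := hmatt a ha
    rw [← hxm]
    exact hmle b (ha.trans hab) x (hx.trans hab)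
  by_contra! hlt
  set V := barrier n p g
  have hVc : Continuous V :=
    continuous_iff_continuousAt.2 fun r => (hasDerivAt_barrier hp hg r).continuousAt
  set D : ℝ → ℝ := fun r => V r - m r
  have hD : Continuous D := hVc.sub hm
  -- If the claim fails, the maximum of $V-m$ on $[0,R]$ exceeds its value at $R$.
  obtain ⟨r₁, hr₁, hmax⟩ := isCompact_Icc.exists_isMaxOn (nonempty_Icc.2 (hr.trans hrR))
    hD.continuousOn (s := Icc 0 R)
  have hDR : D R < D r₁ := by
    have : D r ≤ D r₁ := hmax ⟨hr, hrR⟩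
    have h2 : D R < D r := by simp only [D]; linarith
    linarith
  have hR : 0 < R := by
    rcases (hr.trans hrR).eq_or_lt with h | h
    · have : r₁ = R := le_antisymm hr₁.2 (h ▸ hr₁.1)
      rw [this] at hDR
      exact absurd hDR (lt_irrefl _)
    · exact h
  -- uniform continuity and positivity of `f` on the range of values involved
  have hJ : Icc (m R) (m 0 + 1) ⊆ Ioi 0 := fun t ht => (hmpos R).trans_le ht.1
  have hJne : (Icc (m R) (m 0 + 1)).Nonempty :=
    nonempty_Icc.2 (by linarith [hanti 0 R le_rfl hR.le])
  obtain ⟨t₀, ht₀, hmin⟩ := isCompact_Icc.exists_isMinOn hJne (hf.mono hJ)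
  have hf0 : 0 < f t₀ := hfpos _ (hJ ht₀)
  obtain ⟨η₀, hη₀, huni⟩ := Metric.uniformContinuousOn_iff.1
    (isCompact_Icc.uniformContinuousOn_of_continuous (hf.mono hJ)) (f t₀ / 2) (half_pos hf0)
  set δ := (D r₁ - D R) / 4
  have hδ : 0 < δ := by simp only [δ]; linarith
  -- Below $\eta_0$, so that $f$ varies by less than half its minimum; at most 1, so that values of
  -- $u$ stay in the chosen interval; at most $\delta$, so that a gap remains near $R$.
  set η := min (min (η₀ / 2) 1) δ
  have hη : 0 < η := by positivity
  have hη1 : η < η₀ := by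
    have : η ≤ η₀ / 2 := (min_le_left _ _).trans (min_le_left _ _)
    linarith
  have hη2 : η ≤ 1 := (min_le_left _ _).trans (min_le_right _ _)
  have hη3 : η ≤ δ := min_le_right _ _
  -- The cut-off varies only in this shell. There $V\circ N-(D(r_1)-\eta)-u\le
  -- D(R)+2\delta-D(r_1)+\eta\le-\delta$, as $D(r_1)-D(R)=4\delta$.
  obtain ⟨R', ⟨hR'0, hR'R⟩, hR'⟩ : ∃ R' ∈ Ico 0 R, ∀ s ∈ Icc R' R, D s ≤ D R + 2 * δ := by
    obtain ⟨d, hd, h⟩ := Metric.continuous_iff.1 hD R (2 * δ) (by linarith)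
    refine ⟨max 0 (R - d / 2), ⟨le_max_left _ _, max_lt hR (by linarith)⟩, fun s hs => ?_⟩
    have h1 : R - d / 2 ≤ s := (le_max_right _ _).trans hs.1
    have h2 := h s (by rw [Real.dist_eq, abs_lt]; constructor <;> linarith [hs.2])
    rw [Real.dist_eq, abs_lt] at h2
    linarith [h2.2]
  obtain ⟨χ, hχ, hχ0, hχ1, hχs, hχg⟩ := he.exists_cutoff hH hR'R
  have hNm : ∀ x, m (dualGauge e x) ≤ u x := fun x =>
    hmle _ (he.dualGauge_nonneg hH x) x le_rfl
  have hgrad : ∀ x, HasGradientAt (fun x => V (dualGauge e x) - (D r₁ - η))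
      (barrierSlope n p g (dualGauge e x) • e x) x := by
    intro x
    have := hasGradientAt_barrier he hH hp hg x
    rw [hasGradientAt_iff_hasFDerivAt] at this ⊢
    exact this.sub_const _
  have key := weak_comparison hH hp huc hG hgrad (continuous_barrier_gradient he hH hp hg)
    (b := fun x => g (dualGauge e x)) (c := fun x => f (u x))
    (hg.comp (he.continuous_dualGauge hH)) (hf.comp_continuous huc hupos)
    (fun φ hφ => integral_inner_anisotropicField_barrier hn he hH hp hg hg0 hφ) hsup hχ hχ0 hδ
    (fun x hx => by
      obtain ⟨h1, h2⟩ := hχg x hx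
      have h3 := hR' _ ⟨h1.le, h2⟩
      have h4 := hNm x
      simp only [D, δ] at *
      linarith)
    -- Where $u$ lies below the translated barrier, $m(N)\le u<m(N)+\eta$. Hence $f(u)>f(m(N))/2$:
    -- the factor $1/2$ in $g$ supplies the strict inequality.
    (fun x hx hux => by
      have hxR := hχs x hx
      have hN0 := he.dualGauge_nonneg hH x
      have h1 : D (dualGauge e x) ≤ D r₁ := hmax ⟨hN0, hxR.le⟩
      have h2 := hNm x
      have h3 : u x < m (dualGauge e x) + η := by
        simp only [D] at h1 hux
        linarith
      have h4 := hanti _ R hN0 hxR.le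
      have h5 := hanti 0 _ le_rfl hN0
      have ht : m (dualGauge e x) ∈ Icc (m R) (m 0 + 1) := ⟨h4, by linarith⟩
      have hux' : u x ∈ Icc (m R) (m 0 + 1) := ⟨by linarith, by linarith⟩
      have h6 := huni _ ht _ hux' (by
        rw [Real.dist_eq, abs_lt]
        constructor <;> linarith)
      rw [Real.dist_eq, abs_lt] at h6
      have h7 : f t₀ ≤ f (m (dualGauge e x)) := hmin ht
      simp only [g]
      linarith [h6.2])
  -- At a point realising $m(r_1)$ the comparison would give $V(r_1)\le V(N(x))\le V(r_1)-\eta$.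
  obtain ⟨x, hx, hxm⟩ := hmatt r₁ hr₁.1
  have hr₁R' : r₁ ≤ R' := by
    by_contra! h
    have := hR' r₁ ⟨h.le, hr₁.2⟩
    simp only [δ] at *
    linarith
  have h1 := key x (by rw [hχ1 x (hx.trans hr₁R')]; exact one_ne_zero)
  have h2 : V r₁ ≤ V (dualGauge e x) :=
    barrier_antitoneOn hp hg hg0 (he.dualGauge_nonneg hH x) hr₁.1 hx
  simp only [D] at h1
  linarith

end RadialMinimum

/-! ### One-dimensional integral inequalities. -/

section OneDimensional

/-- Tangent line inequality for the convex function `y ↦ y ^ (-q)` at `1`. -/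
lemma one_sub_mul_le_rpow_neg {q y : ℝ} (hq : 0 ≤ q) (hy : 0 < y) :
    1 - q * (y - 1) ≤ y ^ (-q) := by
  rw [Real.rpow_def_of_pos hy]
  have h1 := Real.add_one_le_exp (Real.log y * -q)
  have h2 := Real.log_le_sub_one_of_pos hy
  nlinarith

/-- Comparison of integrals under a monotone substitution whose slope is only bounded below. -/
lemma integral_mul_le_sub_of_slope_le {m k V h Φ : ℝ → ℝ} {a b : ℝ} (hab : a ≤ b)
    (hm : Continuous m) (hmpos : ∀ r, 0 < m r) (hk : Continuous k)
    (hkpos : ∀ r, a ≤ r → 0 < k r) (hV : ∀ r, HasDerivAt V (-k r) r)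
    (hmV : ∀ r R, a ≤ r → r ≤ R → V r - V R ≤ m r - m R)
    (hh : ContinuousOn h (Ioi 0)) (hhpos : ∀ t, 0 < t → 0 < h t)
    (hΦ : ∀ t, 0 < t → HasDerivAt Φ (h t) t) :
    ∫ r in a..b, h (m r) * k r ≤ Φ (m a) - Φ (m b) := by
  have hhm : Continuous fun r => h (m r) := hh.comp_continuous hm hmpos
  have hhk : Continuous fun r => h (m r) * k r := hhm.mul hk
  have hΦm : Continuous fun r => Φ (m r) := continuous_iff_continuousAt.2 fun r =>
    ContinuousAt.comp (g := Φ) (hΦ _ (hmpos r)).continuousAt hm.continuousAt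
  have hB : ∀ r, HasDerivAt (fun r => Φ (m a) - ∫ s in a..r, h (m s) * k s)
      (-(h (m r) * k r)) r := fun r =>
    (hhk.integral_hasStrictDerivAt a r).hasDerivAt.const_sub _
  -- No differentiability of $m$ is known, so only right difference quotients of $\Phi\circ m$ are
  -- bounded. Mean values give $h(m(y))$ and $k(y')$ at two different points of $[x,z]$, which joint
  -- continuity at $(x,x)$ absorbs.
  have key := image_le_of_liminf_slope_right_le_deriv_boundary (f := fun r => Φ (m r))
    (a := a) (b := b) hΦm.continuousOn (B := fun r => Φ (m a) - ∫ s in a..r, h (m s) * k s)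
    (B' := fun r => -(h (m r) * k r)) (by simp)
    (fun r _ => (hB r).continuousAt.continuousWithinAt) (fun r _ => (hB r).hasDerivWithinAt)
    (fun x hx s hs => by
      refine Eventually.frequently ?_
      have hcont : ContinuousAt (fun q : ℝ × ℝ => -(h (m q.1) * k q.2)) (x, x) :=
        ((hhm.comp continuous_fst).mul (hk.comp continuous_snd)).neg.continuousAt
      obtain ⟨d, hd, hball⟩ := Metric.eventually_nhds_iff.1 (hcont.eventually (gt_mem_nhds hs))
      filter_upwards [Ioo_mem_nhdsGT (show x < x + d by linarith)] with z hz
      obtain ⟨y', hy', hVy'⟩ := exists_hasDerivAt_eq_slope V (fun r => -k r) hz.1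
        (fun r _ => (hV r).continuousAt.continuousWithinAt) (fun r _ => hV r)
      have hzx : 0 < z - x := sub_pos.2 hz.1
      have hky' : 0 < k y' := hkpos y' (hx.1.trans hy'.1.le)
      rw [eq_div_iff hzx.ne'] at hVy'
      have hdrop : k y' * (z - x) ≤ m x - m z := by
        have := hmV x z hx.1 hz.1.le
        linarith
      have hmlt : m z < m x := by
        have : 0 < k y' * (z - x) := by positivity
        linarith
      obtain ⟨ξ, hξ, hΦξ⟩ := exists_hasDerivAt_eq_slope Φ h hmlt
        (fun t ht => (hΦ t ((hmpos z).trans_le ht.1)).continuousAt.continuousWithinAt)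
        (fun t ht => hΦ t ((hmpos z).trans ht.1))
      -- The mean value point lies between $m(z)$ and $m(x)$, so it is itself a value of $m$ near
      -- $x$.
      obtain ⟨y, hy, rfl⟩ : ξ ∈ m '' Icc x z :=
        intermediate_value_Icc' hz.1.le hm.continuousOn ⟨hξ.1.le, hξ.2.le⟩
      rw [eq_div_iff (sub_pos.2 hmlt).ne'] at hΦξ
      have h1 := hball (y := (y, y')) (by
        rw [Prod.dist_eq, max_lt_iff, Real.dist_eq, Real.dist_eq, abs_lt, abs_lt]
        refine ⟨⟨?_, ?_⟩, ⟨?_, ?_⟩⟩ <;> dsimp only <;> linarith [hy.1, hy.2, hz.2, hy'.1, hy'.2])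
      rw [slope_def_field, div_lt_iff₀ hzx]
      have h2 : h (m y) * (k y' * (z - x)) ≤ h (m y) * (m x - m z) :=
        mul_le_mul_of_nonneg_left hdrop (hhpos _ (hmpos y)).le
      have h3 : -(h (m y) * k y') * (z - x) < s * (z - x) := mul_lt_mul_of_pos_right h1 hzx
      linarith)
  have := key (right_mem_Icc.2 hab)
  linarith

lemma exists_hasDerivAt_of_integrableOn {h : ℝ → ℝ} (hh : ContinuousOn h (Ioi 0))
    (hhpos : ∀ t, 0 < t → 0 < h t) (hint : IntegrableOn h (Ioo 0 1)) :
    ∃ Φ : ℝ → ℝ, (∀ t, 0 < t → HasDerivAt Φ (h t) t) ∧ ∀ t, 0 < t → 0 ≤ Φ t := by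
  have hii : ∀ t, 0 < t → IntervalIntegrable h volume 0 t := by
    intro t ht
    have h1 : IntervalIntegrable h volume 0 1 :=
      (intervalIntegrable_iff_integrableOn_Ioo_of_le zero_le_one).2 hint
    refine h1.trans (ContinuousOn.intervalIntegrable (hh.mono fun s hs => ?_))
    exact (lt_min one_pos ht).trans_le hs.1
  refine ⟨fun t => ∫ s in (0 : ℝ)..t, h s, fun t ht => ?_, fun t ht => ?_⟩
  · exact intervalIntegral.integral_hasDerivAt_right (hii t ht)
      (hh.stronglyMeasurableAtFilter isOpen_Ioi t ht) (hh.continuousAt (Ioi_mem_nhds ht))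
  · change 0 ≤ ∫ s in (0 : ℝ)..t, h s
    rw [intervalIntegral.integral_of_le ht.le]
    exact setIntegral_nonneg measurableSet_Ioc fun s hs => (hhpos s hs.1).le

variable {n : ℕ} {p : ℝ} {g : ℝ → ℝ}

/-- The flux `∫₀ʳ ρⁿ⁻¹ g(ρ) dρ`. -/
noncomputable def radialFlux (n : ℕ) (g : ℝ → ℝ) (r : ℝ) : ℝ :=
  ∫ ρ in (0 : ℝ)..r, ρ ^ (n - 1) * g ρ

/-- The average is regular at $r=0$, which suits the barrier; the flux is monotone in $r$, which
suits the estimates. -/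
lemma radialAverage_mul_self {r : ℝ} (hr : 0 < r) :
    radialAverage n g r * r = radialFlux n g r / r ^ (n - 1) := by
  have h1 := intervalIntegral.integral_comp_mul_right (a := 0) (b := 1)
    (fun ρ => ρ ^ (n - 1) * g ρ) hr.ne'
  simp only [zero_mul, one_mul, smul_eq_mul] at h1
  have h2 : ∫ σ in (0 : ℝ)..1, (σ * r) ^ (n - 1) * g (σ * r)
      = r ^ (n - 1) * radialAverage n g r := by
    rw [radialAverage, ← intervalIntegral.integral_const_mul]
    congr 1
    funext σ
    rw [mul_pow]
    ring
  rw [h2] at h1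
  rw [radialFlux, eq_div_iff (by positivity)]
  field_simp at h1
  linarith

lemma radialFlux_sub (hg : Continuous g) (a b : ℝ) :
    radialFlux n g b - radialFlux n g a = ∫ ρ in a..b, ρ ^ (n - 1) * g ρ :=
  intervalIntegral.integral_interval_sub_left
    (((continuous_pow _).mul hg).intervalIntegrable _ _)
    (((continuous_pow _).mul hg).intervalIntegrable _ _)

lemma radialFlux_mono (hg : Continuous g) (hg0 : ∀ r, 0 ≤ g r) {a b : ℝ} (ha : 0 ≤ a)
    (hab : a ≤ b) : radialFlux n g a ≤ radialFlux n g b := by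
  rw [← sub_nonneg, radialFlux_sub hg]
  exact intervalIntegral.integral_nonneg hab fun ρ hρ =>
    mul_nonneg (pow_nonneg (ha.trans hρ.1) _) (hg0 _)

lemma radialFlux_pos (hg : Continuous g) (hg0 : ∀ r, 0 < g r) {r : ℝ} (hr : 0 < r) :
    0 < radialFlux n g r := by
  refine intervalIntegral.intervalIntegral_pos_of_pos_on
    (((continuous_pow _).mul hg).intervalIntegrable _ _) (fun ρ hρ => ?_) hr
  exact mul_pos (pow_pos hρ.1 _) (hg0 _)

lemma barrierSlope_eq {r : ℝ} (hr : 0 < r) :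
    barrierSlope n p g r = (radialFlux n g r / r ^ (n - 1)) ^ (1 / (p - 1)) := by
  rw [barrierSlope, radialAverage_mul_self hr]

lemma le_barrierSlope (hp : 1 < p) (hg : Continuous g) (hg0 : ∀ r, 0 < g r) {R r : ℝ}
    (hR : 0 < R) (hr : r ∈ Icc R (2 * R)) :
    (radialFlux n g R / (2 * R) ^ (n - 1)) ^ (1 / (p - 1)) ≤ barrierSlope n p g r := by
  have hr0 : 0 < r := hR.trans_le hr.1
  rw [barrierSlope_eq hr0]
  have h1 := radialFlux_pos (n := n) hg hg0 hR
  refine Real.rpow_le_rpow (by positivity) ?_ (one_div_nonneg.2 (by linarith))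
  refine div_le_div₀ (h1.le.trans ?_) ?_ (by positivity) (pow_le_pow_left₀ hr0.le hr.2 _)
  · exact radialFlux_mono hg (fun r => (hg0 r).le) hR.le hr.1
  · exact radialFlux_mono hg (fun r => (hg0 r).le) hR.le hr.1

/-- Jensen's inequality for $y\mapsto y^{-q}$, obtained by integrating the tangent line at $l$.
Since $\rho^{n-1}\ge R^{n-1}$ on $[R,2R]$, the mean of $g$ there is at most $l$. -/
lemma integral_rpow_neg_ge (hg : Continuous g) (hg0 : ∀ r, 0 < g r) {q R : ℝ}
    (hn : 0 < n) (hq : 0 ≤ q) (hR : 0 < R) :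
    R * (radialFlux n g (2 * R) / R ^ n) ^ (-q) ≤ ∫ r in R..(2 * R), g r ^ (-q) := by
  set l := radialFlux n g (2 * R) / R ^ n
  have hl : 0 < l := div_pos (radialFlux_pos hg hg0 (by positivity)) (by positivity)
  have hRR : R ≤ 2 * R := by linarith
  have hgint : ∫ r in R..(2 * R), g r ≤ l * R := by
    have h1 : R ^ (n - 1) * ∫ r in R..(2 * R), g r ≤ radialFlux n g (2 * R) := by
      calc R ^ (n - 1) * ∫ r in R..(2 * R), g r
          = ∫ r in R..(2 * R), R ^ (n - 1) * g r := by rw [intervalIntegral.integral_const_mul]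
        _ ≤ ∫ r in R..(2 * R), r ^ (n - 1) * g r := by
            refine intervalIntegral.integral_mono_on hRR
              ((continuous_const.mul hg).intervalIntegrable _ _)
              (((continuous_pow _).mul hg).intervalIntegrable _ _) fun r hr => ?_
            exact mul_le_mul_of_nonneg_right (pow_le_pow_left₀ hR.le hr.1 _) (hg0 r).le
        _ = radialFlux n g (2 * R) - radialFlux n g R := (radialFlux_sub hg _ _).symm
        _ ≤ _ := by linarith [radialFlux_pos (n := n) hg hg0 hR]
    have h2 : l * R = radialFlux n g (2 * R) / R ^ (n - 1) := by
      obtain ⟨k, rfl⟩ : ∃ k, n = k + 1 := ⟨n - 1, by omega⟩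
      simp only [l, Nat.add_sub_cancel]
      field_simp
      ring
    rw [h2, le_div_iff₀ (by positivity)]
    linarith
  have hpt : ∀ r, l ^ (-q) * (1 - q * (g r / l - 1)) ≤ g r ^ (-q) := by
    intro r
    have h1 := one_sub_mul_le_rpow_neg hq (div_pos (hg0 r) hl)
    rw [Real.div_rpow (hg0 r).le hl.le, le_div_iff₀ (by positivity)] at h1
    linarith
  have hgc : Continuous fun r => g r ^ (-q) := hg.rpow_const fun r => Or.inl (hg0 r).ne'
  have hlc : Continuous fun r => l ^ (-q) * (1 - q * (g r / l - 1)) := by fun_prop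
  calc R * l ^ (-q) ≤ ∫ r in R..(2 * R), l ^ (-q) * (1 - q * (g r / l - 1)) := by
        have h1 : ∫ r in R..(2 * R), l ^ (-q) * (1 - q * (g r / l - 1))
            = l ^ (-q) * ((1 + q) * R - q / l * ∫ r in R..(2 * R), g r) := by
          rw [intervalIntegral.integral_const_mul]
          congr 1
          have h2 : ∀ r, 1 - q * (g r / l - 1) = (1 + q) - q / l * g r := fun r => by ring
          simp_rw [h2]
          rw [intervalIntegral.integral_sub (by simp) ((hg.const_mul _).intervalIntegrable _ _),
            intervalIntegral.integral_const, intervalIntegral.integral_const_mul, smul_eq_mul]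
          ring
        rw [h1, mul_comm]
        refine mul_le_mul_of_nonneg_left ?_ (by positivity)
        have h3 : q / l * ∫ r in R..(2 * R), g r ≤ q / l * (l * R) :=
          mul_le_mul_of_nonneg_left hgint (by positivity)
        have h4 : q / l * (l * R) = q * R := by field_simp
        linarith
    _ ≤ _ := intervalIntegral.integral_mono_on hRR (hlc.intervalIntegrable _ _)
        (hgc.intervalIntegrable _ _) fun r _ => hpt r

end OneDimensional

/-! ### Dyadic argument and conclusion. -/

section Liouville

/-- Otherwise $a$ eventually grows by a factor $2b$ at each step, outrunning $Cb^j$. -/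
lemma frequently_le_of_le_geometric {a : ℕ → ℝ} {C b : ℝ} (ha : ∀ j, 0 < a j) (hb : 0 < b)
    (hle : ∀ j, a j ≤ C * b ^ j) : ∃ᶠ j in atTop, a (j + 1) ≤ 2 * b * a j := by
  intro hev
  obtain ⟨J, hJ⟩ := eventually_atTop.1 hev
  have hgrow : ∀ i, (2 * b) ^ i * a J ≤ a (J + i) := by
    intro i
    induction i with
    | zero => simp
    | succ i ih =>
      have h1 := not_le.1 (hJ (J + i) (by omega))
      have h2 : (2 * b) * ((2 * b) ^ i * a J) ≤ 2 * b * a (J + i) :=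
        mul_le_mul_of_nonneg_left ih (by positivity)
      rw [pow_succ', mul_assoc, ← add_assoc]
      linarith
  have hbound : ∀ i, 2 ^ i * a J ≤ C * b ^ J := by
    intro i
    have h1 := (hgrow i).trans (hle (J + i))
    rw [mul_pow, pow_add] at h1
    have hbi : 0 < b ^ i := by positivity
    refine le_of_mul_le_mul_right ?_ hbi
    linarith
  obtain ⟨i, hi⟩ := pow_unbounded_of_one_lt (C * b ^ J / a J) (one_lt_two (α := ℝ))
  rw [div_lt_iff₀ (ha J)] at hi
  exact absurd (hbound i) (not_le.2 hi)

variable {n : ℕ} {p : ℝ}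

lemma pLowerStar_sub_one (hpn : p < n) : pLowerStar n p - 1 = n * (p - 1) / (n - p) := by
  have : (n : ℝ) - p ≠ 0 := by linarith
  rw [pLowerStar]
  field_simp
  ring

/-- The relation `hs` makes all powers of $R$ cancel; with $s=1/(p-1)$ it forces $q=1/(p_*-1)$. -/
lemma dyadic_scaling {Q₁ Q₂ R s q : ℝ} (hn : 0 < n) (hQ₁ : 0 < Q₁) (hQ₂ : 0 < Q₂) (hR : 0 < R)
    (hs : 1 + n * q = (n - 1) * s) :
    (Q₁ / (2 * R) ^ (n - 1)) ^ s * (R * (Q₂ / R ^ n) ^ (-q))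
      = 2 ^ (-((n - 1) * s)) * (Q₁ ^ s * Q₂ ^ (-q)) := by
  have hc : ((n - 1 : ℕ) : ℝ) = n - 1 := by
    rw [Nat.cast_sub (by omega), Nat.cast_one]
  rw [← Real.rpow_natCast, ← Real.rpow_natCast, hc, Real.div_rpow hQ₁.le (by positivity),
    Real.div_rpow hQ₂.le (by positivity), ← Real.rpow_mul (by positivity),
    ← Real.rpow_mul (by positivity), Real.mul_rpow (by norm_num) hR.le,
    Real.rpow_neg zero_le_two, ← hs, mul_neg, Real.rpow_neg hR.le]
  rw [Real.rpow_add hR, Real.rpow_one]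
  have h1 : 0 < R ^ ((n : ℝ) * q) := by positivity
  have h2 : (0 : ℝ) < 2 ^ (1 + (n : ℝ) * q) := by positivity
  field_simp

/-- A positive function whose decay dominates that of the radial solution driven by it cannot
exist when `f ^ (-1 / (p_* - 1))` is integrable at `0`. -/
theorem false_of_barrier_sub_le (hp : 1 < p) (hpn : p < n) {f : ℝ → ℝ}
    (hf : ContinuousOn f (Ioi 0)) (hfpos : ∀ t : ℝ, 0 < t → 0 < f t)
    (hint : IntegrableOn (fun v : ℝ => f v ^ (-(1 / (pLowerStar n p - 1)))) (Ioo 0 1))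
    {m : ℝ → ℝ} (hm : Continuous m) (hmpos : ∀ r, 0 < m r)
    (hmV : ∀ r R, 0 ≤ r → r ≤ R → barrier n p (fun r => f (m r) / 2) r
      - barrier n p (fun r => f (m r) / 2) R ≤ m r - m R) : False := by
  have hn : 0 < n := by
    rcases Nat.eq_zero_or_pos n with rfl | h
    · norm_num at hpn
      linarith
    · exact h
  set g : ℝ → ℝ := fun r => f (m r) / 2
  have hg : Continuous g := (hf.comp_continuous hm hmpos).div_const 2
  have hg0 : ∀ r, 0 < g r := fun r => half_pos (hfpos _ (hmpos r))
  have hg0' : ∀ r, 0 ≤ g r := fun r => (hg0 r).le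
  set s := 1 / (p - 1)
  set q := 1 / (pLowerStar n p - 1)
  have hnp : (0 : ℝ) < n - p := by linarith
  have hp1 : 0 < p - 1 := by linarith
  have hn0 : (0 : ℝ) < n := by positivity
  have hqeq : q = (n - p) / (n * (p - 1)) := by
    simp only [q]
    rw [pLowerStar_sub_one hpn, one_div_div]
  have hq : 0 < q := by rw [hqeq]; positivity
  have hscale : 1 + n * q = (n - 1) * s := by
    rw [hqeq]
    simp only [s]
    field_simp
    ring
  -- This sign lets $Q(2^j)^{s-q}$ be bounded below by $Q(1)^{s-q}$.
  have hsq : 0 ≤ s - q := by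
    have : s - q = p / (n * (p - 1)) := by
      rw [hqeq]
      simp only [s]
      field_simp
      ring
    rw [this]
    positivity
  set h : ℝ → ℝ := fun t => f t ^ (-q)
  have hh : ContinuousOn h (Ioi 0) := hf.rpow_const fun t ht => Or.inl (hfpos t ht).ne'
  have hhpos : ∀ t, 0 < t → 0 < h t := fun t ht => Real.rpow_pos_of_pos (hfpos t ht) _
  obtain ⟨Φ, hΦ, hΦ0⟩ := exists_hasDerivAt_of_integrableOn hh hhpos hint
  set Q := radialFlux n g
  have hQpos : ∀ r, 0 < r → 0 < Q r := fun r hr => radialFlux_pos hg hg0 hr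
  have hkc : Continuous (barrierSlope n p g) := continuous_barrierSlope hp hg
  have hkpos : ∀ r, 0 < r → 0 < barrierSlope n p g r := fun r hr => by
    rw [barrierSlope_eq hr]
    have := hQpos r hr
    positivity
  have hanti : ∀ r R, 0 ≤ r → r ≤ R → m R ≤ m r := fun r R hr hrR => by
    have h1 := hmV r R hr hrR
    have h2 := barrier_antitoneOn (n := n) hp hg hg0' hr (hr.trans hrR) hrR
    linarith
  -- dyadic lower bound
  have hdyadic : ∀ R, 0 < R →
      2 ^ (-q) * (2 ^ (-((n - 1) * s)) * (Q R ^ s * Q (2 * R) ^ (-q)))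
        ≤ Φ (m R) - Φ (m (2 * R)) := by
    intro R hR
    have hRR : R ≤ 2 * R := by linarith
    have h1 := integral_mul_le_sub_of_slope_le hRR hm hmpos hkc
      (fun r hr => hkpos r (hR.trans_le hr)) (hasDerivAt_barrier hp hg)
      (fun r R' hr hrR => hmV r R' (hR.le.trans hr) hrR) hh hhpos hΦ
    refine le_trans ?_ h1
    have hk0 : 0 ≤ (Q R / (2 * R) ^ (n - 1)) ^ s := by
      have := hQpos R hR
      positivity
    have hgc : Continuous fun r => g r ^ (-q) := hg.rpow_const fun r => Or.inl (hg0 r).ne'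
    calc 2 ^ (-q) * (2 ^ (-((n - 1) * s)) * (Q R ^ s * Q (2 * R) ^ (-q)))
        = 2 ^ (-q) * ((Q R / (2 * R) ^ (n - 1)) ^ s * (R * (Q (2 * R) / R ^ n) ^ (-q))) := by
          rw [dyadic_scaling hn (hQpos R hR) (hQpos _ (by positivity)) hR hscale]
      _ ≤ 2 ^ (-q) * ((Q R / (2 * R) ^ (n - 1)) ^ s * ∫ r in R..(2 * R), g r ^ (-q)) := by
          gcongr
          exact integral_rpow_neg_ge hg hg0 hn hq.le hR
      _ = ∫ r in R..(2 * R), 2 ^ (-q) * (g r ^ (-q) * (Q R / (2 * R) ^ (n - 1)) ^ s) := by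
          rw [intervalIntegral.integral_const_mul, intervalIntegral.integral_mul_const,
            mul_comm (∫ r in R..(2 * R), g r ^ (-q))]
      _ ≤ ∫ r in R..(2 * R), h (m r) * barrierSlope n p g r := by
          refine intervalIntegral.integral_mono_on hRR
            ((continuous_const.mul (hgc.mul continuous_const)).intervalIntegrable _ _)
            (((hh.comp_continuous hm hmpos).mul hkc).intervalIntegrable _ _) fun r hr => ?_
          have h2 : h (m r) = 2 ^ (-q) * g r ^ (-q) := by
            rw [← Real.mul_rpow (by norm_num) (hg0' r)]
            simp only [h, g]
            congr 1
            ring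
          rw [h2, ← mul_assoc]
          exact mul_le_mul_of_nonneg_left (le_barrierSlope hp hg hg0 hR hr)
            (mul_nonneg (by positivity) (Real.rpow_nonneg (hg0' r) _))
  -- growth bound for the flux
  have hgrowth : ∀ R, 1 ≤ R → Q R ≤ m 0 ^ (p - 1) * (2 * R) ^ (n - 1) := by
    intro R hR
    have hR0 : 0 < R := by linarith
    have hRR : R ≤ 2 * R := by linarith
    have h1 := hmV R (2 * R) hR0.le hRR
    rw [barrier_sub hp hg] at h1
    have h2 : R * (Q R / (2 * R) ^ (n - 1)) ^ s
        ≤ ∫ ρ in R..(2 * R), barrierSlope n p g ρ := by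
      have := intervalIntegral.integral_mono_on (μ := volume)
        (f := fun _ => (Q R / (2 * R) ^ (n - 1)) ^ s) hRR
        (continuous_const.intervalIntegrable _ _) (hkc.intervalIntegrable _ _)
        fun r hr => le_barrierSlope hp hg hg0 hR0 hr
      rw [intervalIntegral.integral_const, smul_eq_mul] at this
      linarith
    have hQ := hQpos R hR0
    have hk0 : 0 ≤ (Q R / (2 * R) ^ (n - 1)) ^ s := by positivity
    -- The factor $R\ge1$ is simply dropped: any polynomial bound on $Q$ is enough.
    have h3 : (Q R / (2 * R) ^ (n - 1)) ^ s ≤ m 0 := by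
      have := hanti 0 R le_rfl hR0.le
      have := hmpos (2 * R)
      nlinarith
    have h4 := Real.rpow_le_rpow hk0 h3 hp1.le
    rw [← Real.rpow_mul (by positivity), one_div_mul_cancel hp1.ne', Real.rpow_one,
      div_le_iff₀ (by positivity)] at h4
    exact h4
  have hfreq := frequently_le_of_le_geometric (a := fun j : ℕ => Q (2 ^ j))
    (C := m 0 ^ (p - 1) * 2 ^ (n - 1)) (b := 2 ^ (n - 1)) (fun j => hQpos _ (by positivity))
    (by positivity) (fun j => by
      refine (hgrowth _ (one_le_pow₀ one_le_two)).trans (le_of_eq ?_)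
      rw [mul_pow, ← pow_mul, ← pow_mul, mul_comm j]
      ring)
  -- the increments do not tend to zero
  set c := 2 ^ (-q) * (2 ^ (-((n - 1) * s)) * ((2 * 2 ^ (n - 1)) ^ (-q) * Q 1 ^ (s - q)))
  have hc : 0 < c := by
    have := hQpos 1 one_pos
    positivity
  set T : ℕ → ℝ := fun j => Φ (m (2 ^ j))
  have hT : ∃ᶠ j in atTop, c ≤ T j - T (j + 1) := by
    refine hfreq.mono fun j hj => ?_
    have h1 := hdyadic (2 ^ j) (by positivity)
    simp only [T]
    rw [pow_succ' (2 : ℝ) j] at hj ⊢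
    refine le_trans ?_ h1
    have hQ1 := hQpos 1 one_pos
    have hQj := hQpos (2 ^ j) (by positivity)
    have hQj' := hQpos (2 * 2 ^ j) (by positivity)
    have hmono : Q 1 ≤ Q (2 ^ j) := radialFlux_mono hg hg0' zero_le_one (one_le_pow₀ one_le_two)
    refine mul_le_mul_of_nonneg_left (mul_le_mul_of_nonneg_left ?_ (by positivity)) (by positivity)
    calc (2 * 2 ^ (n - 1)) ^ (-q) * Q 1 ^ (s - q)
        ≤ (2 * 2 ^ (n - 1)) ^ (-q) * Q (2 ^ j) ^ (s - q) := by gcongr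
      _ = Q (2 ^ j) ^ s * (2 * 2 ^ (n - 1) * Q (2 ^ j)) ^ (-q) := by
          rw [Real.mul_rpow (by positivity) hQj.le, sub_eq_add_neg, Real.rpow_add hQj]
          ring
      _ ≤ Q (2 ^ j) ^ s * Q (2 * 2 ^ j) ^ (-q) :=
          mul_le_mul_of_nonneg_left
            (Real.rpow_le_rpow_of_nonpos hQj' hj (by linarith)) (by positivity)
  have hTanti : Antitone T := antitone_nat_of_succ_le fun j => by
    have h1 := hdyadic (2 ^ j) (by positivity)
    have hQj := hQpos (2 ^ j) (by positivity)
    have hQj' := hQpos (2 * 2 ^ j) (by positivity)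
    have h2 : 0 ≤ 2 ^ (-q) * (2 ^ (-((n - 1) * s)) * (Q (2 ^ j) ^ s * Q (2 * 2 ^ j) ^ (-q))) := by
      positivity
    simp only [T]
    rw [pow_succ' (2 : ℝ) j]
    linarith
  -- A decreasing sequence bounded below converges, so its increments tend to zero, against `hT`.
  have hTlim := tendsto_atTop_ciInf hTanti ⟨0, by
    rintro _ ⟨j, rfl⟩
    exact hΦ0 _ (hmpos _)⟩
  have hTz := hTlim.sub (hTlim.comp (tendsto_add_atTop_nat 1))
  rw [sub_self] at hTz
  exact hT ((hTz.eventually (gt_mem_nhds hc)).mono fun j hj => not_le.2 hj)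

/-- Nonexistence of positive supersolutions under the integral condition at `0`. -/
theorem not_exists_positiveSupersolution (hp : 1 < p) (hpn : p < n)
    {H : EuclideanSpace ℝ (Fin n) → ℝ} (hH : IsAnisotropy H) {f : ℝ → ℝ}
    (hf : ContinuousOn f (Ioi 0)) (hfpos : ∀ t : ℝ, 0 < t → 0 < f t)
    (hint : IntegrableOn (fun v : ℝ => f v ^ (-(1 / (pLowerStar n p - 1)))) (Ioo 0 1)) :
    ¬ ∃ u : EuclideanSpace ℝ (Fin n) → ℝ, IsPositiveSupersolution p H f u := by
  rintro ⟨u, hu⟩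
  have hn : 0 < n := by
    rcases Nat.eq_zero_or_pos n with rfl | h
    · norm_num at hpn
      linarith
    · exact h
  obtain ⟨e, he⟩ := hH.exists_supportMap
  obtain ⟨m, hm, hmpos, hmle, hmatt⟩ := he.exists_radialMinimum hH hu.1 hu.2.1
  exact false_of_barrier_sub_le hp hpn hf hfpos hint hm hmpos fun r R hr hrR =>
    barrier_sub_le_radialMinimum hn he hH hp hf hfpos hu hm hmpos hmle hmatt hr hrR

/-- The integrand is bounded: near $0$ because $f$ exceeds a positive constant, and on the rest of
the interval by compactness. -/
lemma integrableOn_rpow_neg_of_liminf_pos {f : ℝ → ℝ} (hf : ContinuousOn f (Ioi 0))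
    (hfpos : ∀ t : ℝ, 0 < t → 0 < f t)
    (hlim : 0 < liminf (fun t : ℝ => (f t : EReal)) (𝓝[>] (0 : ℝ))) {q : ℝ} (hq : 0 ≤ q) :
    IntegrableOn (fun v : ℝ => f v ^ (-q)) (Ioo 0 1) := by
  obtain ⟨c, hc0, hc⟩ := EReal.lt_iff_exists_real_btwn.1 hlim
  have hc0 : 0 < c := by exact_mod_cast hc0
  have hev := eventually_lt_of_lt_liminf hc
  obtain ⟨d, hd, hdc⟩ := mem_nhdsGT_iff_exists_Ioo_subset.1 hev
  have hd : 0 < d := hd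
  have hcont : ContinuousOn (fun v : ℝ => f v ^ (-q)) (Ioi 0) :=
    hf.rpow_const fun t ht => Or.inl (hfpos t ht).ne'
  obtain ⟨M, hM⟩ := (isCompact_Icc (a := d) (b := 1)).exists_bound_of_continuousOn
    (hcont.mono fun t ht => hd.trans_le ht.1)
  refine Integrable.of_bound
    ((hcont.mono Ioo_subset_Ioi_self).aestronglyMeasurable measurableSet_Ioo)
    (max M (c ^ (-q))) ?_
  refine (ae_restrict_iff' measurableSet_Ioo).2 (Eventually.of_forall fun t ht => ?_)
  by_cases htd : t < d
  · refine le_trans ?_ (le_max_right _ _)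
    have h1 : c < f t := by
      have : (c : EReal) < (f t : EReal) := hdc ⟨ht.1, htd⟩
      exact_mod_cast this
    rw [Real.norm_of_nonneg (Real.rpow_nonneg (hfpos t ht.1).le _)]
    exact Real.rpow_le_rpow_of_nonpos hc0 h1.le (by linarith)
  · exact (hM t ⟨not_lt.1 htd, ht.2.le⟩).trans (le_max_left _ _)

end Liouville

theorem theorem1p1 (n : ℕ) (p : ℝ) (hp : 1 < p) (hpn : p < (n : ℝ))
    (H : EuclideanSpace ℝ (Fin n) → ℝ) (hH : IsAnisotropy H) :
    (∀ f : ℝ → ℝ, ContinuousOn f (Ioi 0) → (∀ t : ℝ, 0 < t → 0 < f t) →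
      IntegrableOn (fun v : ℝ => f v ^ (-(1 / (pLowerStar n p - 1)))) (Ioo 0 1) →
      ¬ ∃ u : EuclideanSpace ℝ (Fin n) → ℝ, IsPositiveSupersolution p H f u) ∧
    (∀ f : ℝ → ℝ, ContinuousOn f (Ioi 0) → (∀ t : ℝ, 0 < t → 0 < f t) →
      0 < liminf (fun t : ℝ => (f t : EReal)) (𝓝[>] (0 : ℝ)) →
      ¬ ∃ u : EuclideanSpace ℝ (Fin n) → ℝ, IsPositiveSupersolution p H f u) ∧
    (∀ α : ℝ, α < pLowerStar n p - 1 →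
      ¬ ∃ u : EuclideanSpace ℝ (Fin n) → ℝ,
        IsPositiveSupersolution p H (fun t : ℝ => t ^ α) u) := by
  have hpos : 0 < pLowerStar n p - 1 := by
    rw [pLowerStar_sub_one hpn]
    have h1 : 0 < p - 1 := by linarith
    have h2 : 0 < (n : ℝ) - p := by linarith
    have h3 : (0 : ℝ) < n := by linarith
    positivity
  refine ⟨fun f hf hfpos hint => not_exists_positiveSupersolution hp hpn hH hf hfpos hint,
    fun f hf hfpos hlim => not_exists_positiveSupersolution hp hpn hH hf hfpos
      (integrableOn_rpow_neg_of_liminf_pos hf hfpos hlim (one_div_nonneg.2 hpos.le)),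
    fun α hα => not_exists_positiveSupersolution hp hpn hH ?_
      (fun t ht => Real.rpow_pos_of_pos ht α) ?_⟩
  · exact continuousOn_id.rpow_const fun t ht => Or.inl (ne_of_gt ht)
  -- The power of $v$ is $-\alpha/(p_*-1)$, which exceeds $-1$ exactly when $\alpha<p_*-1$.
  · have h1 : IntegrableOn (fun v : ℝ => v ^ (α * -(1 / (pLowerStar n p - 1)))) (Ioo 0 1) := by
      rw [intervalIntegral.integrableOn_Ioo_rpow_iff one_pos]
      have : α * (1 / (pLowerStar n p - 1)) < 1 := by
        rw [mul_one_div, div_lt_one hpos]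
        exact hα
      linarith
    refine h1.congr_fun (fun v hv => ?_) measurableSet_Ioo
    exact Real.rpow_mul hv.1.le _ _
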